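/- Let $p$ be a prime, $\Gamma$ a profinite group, and $\chi:\Gamma\to\mathbb Z_p^\times$ a continuous character. Write $\mathbb Z_p(1)$ for $\mathbb Z_p$ with $\Gamma$ acting through $\chi$, and $\mathbb Z/p^r(1)$, $\mathbb F_p(1)$ for its reductions. All cohomology is continuous cohomology with discrete coefficients. Assume that $\Gamma$ is $p$-manageable with respect to $\mathbb Z_p(1)$, that is: (a) some pro-$p$-Sylow subgroup $\Gamma_p\subset\Gamma$ is Demushkin: $\dim_{\mathbb F_p}H^2(\Gamma_p,\mathbb F_p)=1$, and the cup-product pairing $H^1(\Gamma_p,\mathbb F_p)\times H^1(\Gamma_p,\mathbb F_p)\to H^2(\Gamma_p,\mathbb F_p)$ has trivial left kernel (no finite generation is required); (b) for a pro-$p$-Sylow subgroup $\Gamma_p$ of $\Gamma$ (they are all conjugate), the map $H^1(\Gamma_p,\mathbb Z/p^r(1))\to H^1(\Gamma_p,\mathbb F_p(1))$ is surjective for every $r\ge 2$. Definitions. A $(\Gamma,r)$-bundle of rank $d$ is a free $\mathbb Z/p^r$-module of rank $d$ with a linear action of $\Gamma$ that factors through the quotient by an open normal subgroup. A complete $(\Gamma,r)$-flag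 $\nabla$ of rank $d$ is such a bundle $V=V_d$ with sub-$(\Gamma,r)$-bundles $0=V_0\subset V_1\subset\dots\subset V_d$, where $V_i$ has rank $i$; put $L_k=V_k/V_{k-1}$. For $1\le k\le d$, let $i_r(k)$ be the smallest $0\le i\le k-1$ such that $0\to V_{k-1}/V_i\to V_k/V_i\to L_k\to 0$ splits $\Gamma$-equivariantly, and let $i_1(k)$ be the same number for the reduction of the flag modulo $p$. By recursion on $d$ (the flag of rank $0$ being Kummer), $\nabla$ is a Kummer flag if: (1) $i_r(k)=i_1(k)$ for all $1\le k\le d$; (2) each $L_k$ is isomorphic to $\mathbb Z/p^r$ with trivial action; (3) the truncated flag $V_0\subset\dots\subset V_{d-1}$ and the quotient flag $0\subset V_2/V_1\subset\dots\subset V_d/V_1$ are Kummer; (4) for all $2\le k\le d$ with $i_r(k)=0$ and every $\Gamma$-equivariant section $s:L_k\to V_k$ of $V_k\to L_k$, the flag of rank $d-1$ induced by $\nabla$ on $V/s(L_k)$ is Kummer. A bundle is unipotent if it has a complete flag whose graded pieces $L_k$ are all trivial; equivalently, in a suitable basis $\Gamma$ acts by upper unitriangular matrices. Corollary. Let $r\ge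 2$ and assume $\mathbb Z/p^r(1)\simeq\mathbb Z/p^r$ as $\Gamma$-modules. (i) If $V$ is a $(\Gamma,r)$-bundle that underlies a Kummer flag, then the reduction map $H^1(\Gamma,V)\to H^1(\Gamma,V/p)$ is surjective. (ii) For every unipotent $(\Gamma,1)$-bundle $V_1$ there is a unipotent $(\Gamma,r)$-bundle $V_r$, with $V_r/p\simeq V_1$ as $\Gamma$-modules, such that $H^1(\Gamma,V_r)\to H^1(\Gamma,V_r/p)=H^1(\Gamma,V_1)$ is surjective. -/

import Mathlib

universe u v

namespace KummerFlags

/-! ### Continuous cohomology in degrees one and two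

For a topological group `G` and a `G`-module `M` with the discrete topology, continuous cohomology
is computed by continuous (that is, locally constant) inhomogeneous cochains. -/

section Cohomology

variable {k G M N : Type*} [CommRing k] [Group G] [TopologicalSpace G]
  [AddCommGroup M] [Module k M] [AddCommGroup N] [Module k N]

/-- Continuous `1`-cocycles: `f (g h) = g • f h + f g`. -/
def Z1 (ρ : Representation k G M) : Submodule k (G → M) where
  carrier := {f | IsLocallyConstant f ∧ ∀ g h, f (g * h) = ρ g (f h) + f g}
  zero_mem' := ⟨IsLocallyConstant.const 0, fun g h => by simp⟩
  add_mem' := by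
    rintro a b ⟨ha, ha'⟩ ⟨hb, hb'⟩
    refine ⟨ha.add hb, fun g h => ?_⟩
    simp only [Pi.add_apply, ha', hb', map_add]
    abel
  smul_mem' := by
    rintro c a ⟨ha, ha'⟩
    refine ⟨ha.comp (fun x => c • x), fun g h => ?_⟩
    simp only [Pi.smul_apply, ha', map_smul, smul_add]

/-- `1`-coboundaries: `g ↦ g • m - m`. -/
def B1 (ρ : Representation k G M) : Submodule k (Z1 ρ) where
  carrier := {f | ∃ m : M, ∀ g, f.1 g = ρ g m - m}
  zero_mem' := ⟨0, fun g => by simp⟩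
  add_mem' := by
    rintro a b ⟨m, hm⟩ ⟨n, hn⟩
    refine ⟨m + n, fun g => ?_⟩
    simp only [Submodule.coe_add, Pi.add_apply, hm, hn, map_add]
    abel
  smul_mem' := by
    rintro c a ⟨m, hm⟩
    refine ⟨c • m, fun g => ?_⟩
    simp only [Submodule.coe_smul, Pi.smul_apply, hm, map_smul, smul_sub]

/-- `H¹(G, M)`. -/
abbrev H1 (ρ : Representation k G M) : Type _ := Z1 ρ ⧸ B1 ρ

/-- Continuous `2`-cocycles: `g • f (h, l) - f (g h, l) + f (g, h l) - f (g, h) = 0`. -/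
def Z2 (ρ : Representation k G M) : Submodule k (G × G → M) where
  carrier := {f | IsLocallyConstant f ∧
    ∀ g h l, f (g * h, l) + f (g, h) = ρ g (f (h, l)) + f (g, h * l)}
  zero_mem' := ⟨IsLocallyConstant.const 0, fun g h l => by simp⟩
  add_mem' := by
    rintro a b ⟨ha, ha'⟩ ⟨hb, hb'⟩
    refine ⟨ha.add hb, fun g h l => ?_⟩
    have h1 := ha' g h l
    have h2 := hb' g h l
    simp only [Pi.add_apply, map_add]
    calc _ = (a (g * h, l) + a (g, h)) + (b (g * h, l) + b (g, h)) := by abel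
      _ = _ := by rw [h1, h2]; abel
  smul_mem' := by
    rintro c a ⟨ha, ha'⟩
    refine ⟨ha.comp (fun x => c • x), fun g h l => ?_⟩
    simp only [Pi.smul_apply, map_smul, ← smul_add, ha']

/-- `2`-coboundaries: `(g, h) ↦ g • c h - c (g h) + c g`, with `c` continuous. -/
def B2 (ρ : Representation k G M) : Submodule k (Z2 ρ) where
  carrier := {f | ∃ c : G → M, IsLocallyConstant c ∧
    ∀ g h, f.1 (g, h) = ρ g (c h) - c (g * h) + c g}
  zero_mem' := ⟨0, IsLocallyConstant.const 0, fun g h => by simp⟩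
  add_mem' := by
    rintro a b ⟨m, hm, hm'⟩ ⟨n, hn, hn'⟩
    refine ⟨m + n, hm.add hn, fun g h => ?_⟩
    simp only [Submodule.coe_add, Pi.add_apply, hm', hn', map_add]
    abel
  smul_mem' := by
    rintro c a ⟨m, hm, hm'⟩
    refine ⟨c • m, hm.comp (fun x => c • x), fun g h => ?_⟩
    simp only [Submodule.coe_smul, Pi.smul_apply, hm', map_smul, smul_sub, smul_add]

/-- `H²(G, M)`. -/
abbrev H2 (ρ : Representation k G M) : Type _ := Z2 ρ ⧸ B2 ρ

/-- The map on cocycles induced by a `G`-equivariant map of coefficients. -/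
def Z1.map {ρ : Representation k G M} {σ : Representation k G N}
    (φ : Representation.IntertwiningMap ρ σ) : Z1 ρ →ₗ[k] Z1 σ where
  toFun f := ⟨fun g => φ (f.1 g), f.2.1.comp φ, fun g h => by
    change φ (f.1 (g * h)) = σ g (φ (f.1 h)) + φ (f.1 g)
    rw [f.2.2, map_add, φ.isIntertwining]⟩
  map_add' a b := by ext g; simp
  map_smul' c a := by ext g; simp

/-- The map `H¹(G, M) → H¹(G, N)` induced by a `G`-equivariant map of coefficients. -/
def H1.map {ρ : Representation k G M} {σ : Representation k G N}
    (φ : Representation.IntertwiningMap ρ σ) : H1 ρ →ₗ[k] H1 σ :=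
  Submodule.mapQ (B1 ρ) (B1 σ) (Z1.map φ) (by
    rintro f ⟨m, hm⟩
    refine ⟨φ m, fun g => ?_⟩
    change φ (f.1 g) = _
    rw [hm, map_sub, φ.isIntertwining])

variable (k G) in
/-- The cup product of cocycles with trivial coefficients `k`: `(a ∪ b) (g, h) = a g * b h`. -/
def cupCocycle : Z1 (Representation.trivial k G k) →ₗ[k]
    Z1 (Representation.trivial k G k) →ₗ[k] Z2 (Representation.trivial k G k) :=
  LinearMap.mk₂ k
    (fun a b => ⟨fun x => a.1 x.1 * b.1 x.2,
      (a.2.1.comp_continuous continuous_fst).mul (b.2.1.comp_continuous continuous_snd),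
      fun g h l => by
        have h1 := a.2.2 g h
        have h2 := b.2.2 h l
        simp only [Representation.trivial_apply] at h1 h2 ⊢
        rw [h1, h2]
        ring⟩)
    (fun a a' b => by ext x; simp [add_mul])
    (fun c a b => by ext x; simp [mul_assoc])
    (fun a b b' => by ext x; simp [mul_add])
    (fun c a b => by ext x; simp [mul_left_comm])

/-- For the trivial action there are no nonzero `1`-coboundaries. -/
theorem eq_zero_of_mem_B1_trivial {a : Z1 (Representation.trivial k G k)}
    (ha : a ∈ B1 (Representation.trivial k G k)) : a = 0 := by
  obtain ⟨m, hm⟩ := ha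
  ext g
  simp [hm g]

variable (k G) in
/-- The cup product `H¹(G, k) × H¹(G, k) → H²(G, k)`, for the trivial action of `G` on `k`. -/
def cup : H1 (Representation.trivial k G k) →ₗ[k]
    H1 (Representation.trivial k G k) →ₗ[k] H2 (Representation.trivial k G k) :=
  Submodule.liftQ (B1 (Representation.trivial k G k))
    (LinearMap.flip (Submodule.liftQ (B1 (Representation.trivial k G k))
      (LinearMap.flip ((cupCocycle k G).compr₂
        (Submodule.mkQ (B2 (Representation.trivial k G k)))))
      (fun b hb => by
        rw [eq_zero_of_mem_B1_trivial hb]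
        exact Submodule.zero_mem _)))
    (fun a ha => by
      rw [eq_zero_of_mem_B1_trivial ha]
      exact Submodule.zero_mem _)

end Cohomology

/-! ### `p`-manageable profinite groups -/

section Manageable

/-- A profinite group `G` is pro-`p` if all its quotients by open normal subgroups are
`p`-groups. -/
def IsProP (p : ℕ) (G : Type*) [Group G] [TopologicalSpace G] : Prop :=
  ∀ N : Subgroup G, ∀ _ : N.Normal, IsOpen (N : Set G) → IsPGroup p (G ⧸ N)

/-- `P` is a pro-`p`-Sylow subgroup of the profinite group `G`: it is closed, pro-`p`, and its
(supernatural) index is prime to `p`. -/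
structure IsProPSylow (p : ℕ) {G : Type*} [Group G] [TopologicalSpace G] (P : Subgroup G) :
    Prop where
  isClosed : IsClosed (P : Set G)
  isProP : IsProP p P
  index : ∀ N : Subgroup G, N.Normal → IsOpen (N : Set G) → ¬ p ∣ (P ⊔ N).index

/-- The Demushkin property (no finite generation is required): `H²(G, 𝔽_p)` is one-dimensional and
the cup-product pairing on `H¹(G, 𝔽_p)` has trivial left kernel. -/
structure IsDemushkin (p : ℕ) [Fact p.Prime] (G : Type*) [Group G] [TopologicalSpace G] :
    Prop where
  finrank_H2 : Module.finrank (ZMod p) (H2 (Representation.trivial (ZMod p) G (ZMod p))) = 1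
  left_kernel : ∀ a : H1 (Representation.trivial (ZMod p) G (ZMod p)),
    (∀ b, cup (ZMod p) G a b = 0) → a = 0

/-- A profinite group is `p`-Demushkin if it has a pro-`p`-Sylow subgroup that is Demushkin. -/
def IsPDemushkin (p : ℕ) [Fact p.Prime] (G : Type*) [Group G] [TopologicalSpace G] : Prop :=
  ∃ P : Subgroup G, IsProPSylow p P ∧ IsDemushkin p P

/-- The `G`-module `(ℤ/p^r)(1)`, reduction of the module `ℤ_p(1)` given by a character
`χ : G → ℤ_pˣ`: an element `g` acts as multiplication by `χ g` mod `p^r`. -/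
noncomputable def tate (p : ℕ) [Fact p.Prime] {G : Type*} [Group G] (χ : G →* ℤ_[p]ˣ) (r : ℕ) :
    Representation (ZMod (p ^ r)) G (ZMod (p ^ r)) where
  toFun g := LinearMap.mulLeft (ZMod (p ^ r)) (PadicInt.toZModPow r (χ g : ℤ_[p]))
  map_one' := by ext; simp
  map_mul' g h := by ext; simp

end Manageable

/-! ### Representations: sub-, quotients and reduction modulo `p` -/

section Reps

variable {R G V : Type*} [CommRing R] [Group G] [AddCommGroup V] [Module R V]
  {ρ : Representation R G V}

/-- The quotient `V/S`, as a representation. -/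
def quot (S : Subrepresentation ρ) : Representation R G (V ⧸ S.toSubmodule) :=
  ρ.quotient S.toSubmodule S.apply_mem_toSubmodule

/-- The quotient map `V → V/S`. -/
def quotMap (S : Subrepresentation ρ) : Representation.IntertwiningMap ρ (quot S) :=
  { S.toSubmodule.mkQ with isIntertwining' := fun _ => rfl }

/-- `T ∩ S`, as a subrepresentation of `S`. -/
def subIn (S T : Subrepresentation ρ) : Subrepresentation S.toRepresentation where
  toSubmodule := T.toSubmodule.comap S.toSubmodule.subtype
  apply_mem_toSubmodule g _ hv := T.apply_mem_toSubmodule g hv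

/-- The image `(T + S)/S` of `T` in `V/S`. -/
def imageIn (S T : Subrepresentation ρ) : Subrepresentation (quot S) where
  toSubmodule := T.toSubmodule.map S.toSubmodule.mkQ
  apply_mem_toSubmodule g := by
    rintro _ ⟨v, hv, rfl⟩
    exact ⟨ρ g v, T.apply_mem_toSubmodule g hv, rfl⟩

/-- The subrepresentation `p V`. -/
def pMul (p : ℕ) (ρ : Representation R G V) : Subrepresentation ρ where
  toSubmodule := LinearMap.range ((p : R) • (LinearMap.id : V →ₗ[R] V))
  apply_mem_toSubmodule g := by
    rintro _ ⟨v, rfl⟩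
    exact ⟨ρ g v, by simp⟩

/-- The reduction `V/p`. -/
abbrev modP (p : ℕ) (ρ : Representation R G V) :
    Representation R G (V ⧸ (pMul p ρ).toSubmodule) :=
  quot (pMul p ρ)

/-- The reduction map `H¹(G, V) → H¹(G, V/p)`. -/
def H1.reduction [TopologicalSpace G] (p : ℕ) (ρ : Representation R G V) :
    H1 ρ →ₗ[R] H1 (modP p ρ) :=
  H1.map (quotMap (pMul p ρ))

/-- A bundle of rank `d`: a free module of rank `d`, on which `G` acts through its quotient by an
open subgroup. With `R = ℤ/p^r`, this is a `(G, r)`-bundle. -/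
structure IsBundle [TopologicalSpace G] (ρ : Representation R G V) (d : ℕ) : Prop where
  free : Module.Free R V
  finite : Module.Finite R V
  rank : Module.finrank R V = d
  continuous : IsOpen {g : G | ρ g = 1}

/-! ### Complete flags

A filtration is given by `F : ℕ → Subrepresentation ρ`; for a flag of rank `d`, only
`F 0, …, F d` matter. -/

/-- `0 = F 0 ⊂ F 1 ⊂ ⋯ ⊂ F d = V` is a complete flag, with `F i` free of rank `i`. -/
structure IsCompleteFlag (ρ : Representation R G V) (d : ℕ) (F : ℕ → Subrepresentation ρ) :
    Prop where
  zero : F 0 = ⊥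
  top : F d = ⊤
  mono : ∀ i < d, F i ≤ F (i + 1)
  free : ∀ i ≤ d, Module.Free R (F i).toSubmodule
  rank : ∀ i ≤ d, Module.finrank R (F i).toSubmodule = i

/-- The graded piece `L_k = F k / F (k - 1)`, for `k ≥ 1`. -/
abbrev gradedPiece (F : ℕ → Subrepresentation ρ) (k : ℕ) :
    Representation R G ((F k).toSubmodule ⧸ (subIn (F k) (F (k - 1))).toSubmodule) :=
  quot (subIn (F k) (F (k - 1)))

/-- `L_k` is isomorphic to the trivial representation `R`. -/
def TrivialPiece (F : ℕ → Subrepresentation ρ) (k : ℕ) : Prop :=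
  Nonempty ((gradedPiece F k).Equiv (Representation.trivial R G R))

/-- For a flag `F` and `i < k`, the extension
`0 → F (k - 1) / F i → F k / F i → L_k → 0` splits, i.e. `F (k - 1) / F i` has a stable complement
in `F k / F i`. Here `T / F i` is that complement, the image of a section of `F k / F i → L_k`. -/
def SplitsAt (F : ℕ → Subrepresentation ρ) (i k : ℕ) : Prop :=
  ∃ T : Subrepresentation ρ, T ⊓ F (k - 1) = F i ∧ T ⊔ F (k - 1) = F k

/-- The smallest `0 ≤ i ≤ k - 1` such that `0 → F (k - 1) / F i → F k / F i → L_k → 0` splits (it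
does for `i = k - 1`). -/
noncomputable def splitIndex (F : ℕ → Subrepresentation ρ) (k : ℕ) : ℕ :=
  sInf {i | i ≤ k - 1 ∧ SplitsAt F i k}

/-- The filtration of `V/p` obtained by reduction of `F`. -/
def reduce (p : ℕ) (F : ℕ → Subrepresentation ρ) : ℕ → Subrepresentation (modP p ρ) :=
  fun i => imageIn (pMul p ρ) (F i)

/-- `V` is unipotent: it has a complete flag whose graded pieces are all trivial, i.e. in a suitable
basis the action is by upper unitriangular matrices. -/
def IsUnipotent (ρ : Representation R G V) : Prop :=
  ∃ (d : ℕ) (F : ℕ → Subrepresentation ρ), IsCompleteFlag ρ d F ∧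
    ∀ k, 1 ≤ k → k ≤ d → TrivialPiece F k

end Reps

/-- Kummer flags, by recursion on the rank `d`. For a complete flag `F` of rank `d ≥ 1` on `V`:
* for `1 ≤ k ≤ d`, the split index of `F` at `k` is that of the reduction of `F` modulo `p`;
* all graded pieces are trivial;
* the truncation `F 0 ⊂ ⋯ ⊂ F (d - 1)`, on `F (d - 1)`, and the quotient
  `0 ⊂ F 2 / F 1 ⊂ ⋯ ⊂ F d / F 1`, on `V / F 1`, are Kummer flags;
* for `2 ≤ k ≤ d`, if the split index at `k` is `0`, then for each section `s : L_k → F k`, with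
  image `T = s(L_k)` (the stable complements `T` of `F (k - 1)` in `F k`), the flag induced by `F`
  on `V / T`, with its repetition at the places `k - 1`, `k` removed, is a Kummer flag. -/
def IsKummer (p : ℕ) {R G : Type*} [CommRing R] [Group G] :
    (d : ℕ) → {V : Type v} → [AddCommGroup V] → [Module R V] →
      (ρ : Representation R G V) → (ℕ → Subrepresentation ρ) → Prop
  | 0, _, _, _, _, _ => True
  | d + 1, _, _, _, _, F =>
    (∀ k, 1 ≤ k → k ≤ d + 1 → splitIndex F k = splitIndex (reduce p F) k) ∧
    (∀ k, 1 ≤ k → k ≤ d + 1 → TrivialPiece F k) ∧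
    IsKummer p d (F d).toRepresentation (fun i => subIn (F d) (F i)) ∧
    IsKummer p d (quot (F 1)) (fun i => imageIn (F 1) (F (i + 1))) ∧
    (∀ k, 2 ≤ k → k ≤ d + 1 → splitIndex F k = 0 →
      ∀ T, T ⊓ F (k - 1) = ⊥ → T ⊔ F (k - 1) = F k →
        IsKummer p d (quot T) (fun i => imageIn T (F (if i < k then i else i + 1))))

section Manageable

variable (p : ℕ) [Fact p.Prime] {G : Type*} [Group G] [TopologicalSpace G]

/-- The property wH90 of `(G, ℤ_p(1))`: for a pro-`p`-Sylow subgroup `P` and all `r ≥ 2`, the map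
`H¹(P, (ℤ/p^r)(1)) → H¹(P, 𝔽_p(1))` is onto. (Pro-`p`-Sylow subgroups are conjugate, so the
choice of `P` does not matter.) -/
def WeakH90 (χ : G →* ℤ_[p]ˣ) : Prop :=
  ∀ P : Subgroup G, IsProPSylow p P → ∀ r, 2 ≤ r →
    Function.Surjective (H1.reduction (G := P) p ((tate p χ r).comp P.subtype))

/-- `G` is `p`-manageable with respect to the module `ℤ_p(1)` given by `χ`. -/
structure IsPManageable (χ : G →* ℤ_[p]ˣ) : Prop where
  demushkin : IsPDemushkin p G
  wH90 : WeakH90 p χ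

end Manageable

end KummerFlags

/-! Let `P` be a Demushkin pro-`p`-Sylow subgroup. Since `ℤ/p^r(1)` is trivial, wH90 says that
characters `P → ℤ/p` lift to `ℤ/p^r` (`liftsCharacters_of_weakH90`). Both statements then follow
from one criterion, `IsReduction.exists_lift_Z1_of_functionals`: let `W` be the reduction of a
bundle `V`, and suppose that `P` and `Γ` have the same image on `W`. If every invariant functional
`W → 𝔽_p` lifts to an invariant functional `V → ℤ/p^r`, then cocycles with values in `W` lift to
`V`.

The criterion comes from duality over `P`. By dévissage along fixed lines, the Demushkin property
extends from `𝔽_p` to all finite coefficients: a class in `H²(P, W)` vanishes as soon as every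
invariant functional kills it (`IsDemushkin.isCoboundary_of_functionals`). Pushed forward along a
lifted functional, the obstruction to lifting a cocycle becomes the obstruction to lifting a
character, which is zero. So, after a correction by wH90, all functionals kill the obstruction, and
it is removed one power of `p` at a time (`exists_coboundary_of_pow_smul`). Corestriction passes
from `P` to `Γ`. In a unipotent representation `Γ` acts through a `p`-group, so `P` has the same
image (`IsProPSylow.exists_apply_eq`).

For (i), an invariant functional `f` on the reduction of a Kummer flag is lifted by induction on the
rank (`IsKummer.exists_lift_functional`). Either `f` kills `F 1` and descends to the quotient flag,
or `f` splits `F 2 → L_2` modulo `p`. In the second case the Kummer condition gives an integral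
splitting, which can be moved inside the kernel of `f`, and `f` descends to the quotient by it.

For (ii), let `S ⊂ W` be the common kernel of all invariant functionals, so that `W` is an extension
of a trivial `𝔽_pⁿ` by `S`. By induction `S` has a lift `K` onto whose reduction `H¹` surjects, so
the extension classes lift and define an extension `V` of `(ℤ/p^r)ⁿ` by `K`. All invariant
functionals on `W` factor through `𝔽_pⁿ` and therefore lift (`exists_unitriangular_lift`). -/

namespace KummerFlags

/-! ### Cochain calculus in degrees one and two -/

section Cochains

variable {k k' G M N : Type*} [CommRing k] [CommRing k'] [Group G] [TopologicalSpace G]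
  [AddCommGroup M] [Module k M] [AddCommGroup N] [Module k' N]

/-- The coboundary of a `1`-cochain. -/
def d1 (ρ : Representation k G M) : (G → M) →ₗ[k] (G × G → M) where
  toFun c x := ρ x.1 (c x.2) - c (x.1 * x.2) + c x.1
  map_add' a b := by ext x; simp only [Pi.add_apply, map_add]; abel
  map_smul' t a := by
    ext x; simp only [Pi.smul_apply, map_smul, smul_add, smul_sub, RingHom.id_apply]

omit [TopologicalSpace G] in
theorem d1_apply (ρ : Representation k G M) (c : G → M) (g h : G) :
    d1 ρ c (g, h) = ρ g (c h) - c (g * h) + c g := rfl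

/-- A `2`-cochain is a coboundary if it is the coboundary of a locally constant `1`-cochain. -/
def IsCoboundary (ρ : Representation k G M) (z : G × G → M) : Prop :=
  ∃ c : G → M, IsLocallyConstant c ∧ z = d1 ρ c

variable {ρ : Representation k G M} {σ : Representation k' G N}

theorem IsCoboundary.add {y z : G × G → M} (hy : IsCoboundary ρ y) (hz : IsCoboundary ρ z) :
    IsCoboundary ρ (y + z) := by
  obtain ⟨c, hc, rfl⟩ := hy
  obtain ⟨e, he, rfl⟩ := hz
  exact ⟨c + e, hc.add he, by rw [map_add]⟩

theorem IsCoboundary.smul {z : G × G → M} (t : k) (hz : IsCoboundary ρ z) :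
    IsCoboundary ρ (t • z) := by
  obtain ⟨c, hc, rfl⟩ := hz
  exact ⟨t • c, hc.comp (fun x => t • x), by rw [map_smul]⟩

theorem IsCoboundary.sub {y z : G × G → M} (hy : IsCoboundary ρ y) (hz : IsCoboundary ρ z) :
    IsCoboundary ρ (y - z) := by
  have := hy.add (hz.smul (-1))
  rwa [neg_one_smul, ← sub_eq_add_neg] at this

theorem mem_B2_iff (z : Z2 ρ) : z ∈ B2 ρ ↔ IsCoboundary ρ z.1 := by
  refine ⟨fun ⟨c, hc, h⟩ => ⟨c, hc, funext fun x => h x.1 x.2⟩, fun ⟨c, hc, h⟩ => ⟨c, hc, ?_⟩⟩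
  intro g h'
  rw [h, d1_apply]

theorem isCoboundary_zero : IsCoboundary ρ (0 : G × G → M) :=
  ⟨0, IsLocallyConstant.const 0, (map_zero _).symm⟩

theorem d1_eq_zero_iff {c : G → M} (hc : IsLocallyConstant c) : d1 ρ c = 0 ↔ c ∈ Z1 ρ := by
  constructor
  · refine fun h => ⟨hc, fun g h' => ?_⟩
    have := congrFun h (g, h')
    rw [d1_apply, Pi.zero_apply, sub_add_eq_add_sub, sub_eq_zero] at this
    exact this.symm
  · rintro ⟨-, h⟩
    ext ⟨g, h'⟩
    simp [d1_apply, h]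

theorem isLocallyConstant_d1 [ContinuousMul G] (hρ : IsLocallyConstant fun g => ρ g) {c : G → M}
    (hc : IsLocallyConstant c) : IsLocallyConstant (d1 ρ c) := by
  have h1 : IsLocallyConstant fun x : G × G => ρ x.1 := hρ.comp_continuous continuous_fst
  have h2 : IsLocallyConstant fun x : G × G => c x.2 := hc.comp_continuous continuous_snd
  have h3 : IsLocallyConstant fun x : G × G => c x.1 := hc.comp_continuous continuous_fst
  have h4 : IsLocallyConstant fun x : G × G => c (x.1 * x.2) := hc.comp_continuous continuous_mul
  exact ((h1.comp₂ h2 (fun a b => a b)).sub h4).add h3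

theorem d1_mem_Z2 [ContinuousMul G] (hρ : IsLocallyConstant fun g => ρ g) {c : G → M}
    (hc : IsLocallyConstant c) : d1 ρ c ∈ Z2 ρ := by
  refine ⟨isLocallyConstant_d1 hρ hc, fun g h l => ?_⟩
  simp only [d1_apply, map_add, map_sub, map_mul, mul_assoc, Module.End.mul_apply]
  abel

theorem map_mem_Z2 (f : M →+ N) (hf : ∀ g m, f (ρ g m) = σ g (f m)) {z : G × G → M}
    (hz : z ∈ Z2 ρ) : (fun x => f (z x)) ∈ Z2 σ := by
  refine ⟨hz.1.comp f, fun g h l => ?_⟩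
  rw [← map_add, hz.2, map_add, hf]

omit [TopologicalSpace G] in
theorem map_d1 (f : M →+ N) (hf : ∀ g m, f (ρ g m) = σ g (f m)) (c : G → M) :
    (fun x => f (d1 ρ c x)) = d1 σ (fun g => f (c g)) := by
  ext ⟨g, h⟩
  simp only [d1_apply, map_add, map_sub, hf]

theorem map_mem_Z1 (f : M →+ N) (hf : ∀ g m, f (ρ g m) = σ g (f m)) {c : G → M}
    (hc : c ∈ Z1 ρ) : (fun x => f (c x)) ∈ Z1 σ := by
  refine ⟨hc.1.comp f, fun g h => ?_⟩
  change f (c (g * h)) = _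
  rw [hc.2, map_add, hf]

theorem IsCoboundary.map (f : M →+ N) (hf : ∀ g m, f (ρ g m) = σ g (f m)) {z : G × G → M}
    (hz : IsCoboundary ρ z) : IsCoboundary σ (fun x => f (z x)) := by
  obtain ⟨c, hc, rfl⟩ := hz
  exact ⟨fun g => f (c g), hc.comp f, map_d1 f hf c⟩

theorem isLocallyConstant_of_isOpen_ker [IsTopologicalGroup G]
    (h : IsOpen {g : G | ρ g = 1}) : IsLocallyConstant fun g => ρ g := by
  rw [IsLocallyConstant.iff_eventually_eq]
  intro g
  have h1 : (fun x => g⁻¹ * x) ⁻¹' {g : G | ρ g = 1} ∈ nhds g :=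
    (h.preimage (continuous_const_mul g⁻¹)).mem_nhds (by
      change ρ (g⁻¹ * g) = 1
      rw [inv_mul_cancel, map_one])
  filter_upwards [h1] with x hx
  have : ρ (g * (g⁻¹ * x)) = ρ g := by rw [map_mul, show ρ (g⁻¹ * x) = 1 from hx, mul_one]
  rwa [mul_inv_cancel_left] at this

theorem isOpen_ker (h : IsLocallyConstant fun g => ρ g) : IsOpen {g : G | ρ g = 1} :=
  h.isOpen_fiber 1

end Cochains

/-! ### Fixed vectors of pro-`p` groups -/

section FixedPoints

variable {p : ℕ} [Fact p.Prime] {G : Type*} [Group G] [TopologicalSpace G]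

/-- The image is a finite `p`-group acting on a set of cardinality divisible by `p`. Since `0` is a
fixed point, there must be another one. -/
theorem IsProP.exists_fixed_ne_zero (hG : IsProP p G) {W : Type*} [AddCommGroup W]
    [Module (ZMod p) W] [Finite W] [Nontrivial W] (ρ : Representation (ZMod p) G W)
    (hρ : IsOpen {g : G | ρ g = 1}) : ∃ w : W, w ≠ 0 ∧ ∀ g, ρ g w = w := by
  have hker : (ρ.toHomUnits.ker : Set G) = {g : G | ρ g = 1} := by
    ext g
    simp [MonoidHom.mem_ker]
  have h1 : IsPGroup p (G ⧸ ρ.toHomUnits.ker) := hG _ inferInstance (hker ▸ hρ)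
  have h2 : IsPGroup p ρ.toHomUnits.range :=
    h1.of_equiv (QuotientGroup.quotientKerEquivRange ρ.toHomUnits)
  have hp : p ∣ Nat.card W := by
    obtain ⟨w, hw⟩ := exists_ne (0 : W)
    have h0 : p • w = 0 := by rw [← Nat.cast_smul_eq_nsmul (ZMod p)]; simp
    have := addOrderOf_dvd_natCard w
    rwa [addOrderOf_eq_prime h0 hw] at this
  obtain ⟨w, hw, hne⟩ := h2.exists_fixed_point_of_prime_dvd_card_of_fixed_point W hp
    (a := (0 : W)) (fun g => smul_zero g)
  exact ⟨w, hne.symm, fun g => hw ⟨ρ.toHomUnits g, g, rfl⟩⟩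

end FixedPoints

/-! ### The Demushkin property on cocycles, and dual cocycles -/

section Duality

variable (p : ℕ) [Fact p.Prime] (G : Type*) [Group G] [TopologicalSpace G]

/-- The trivial representation on `𝔽_p`. -/
abbrev triv : Representation (ZMod p) G (ZMod p) := Representation.trivial (ZMod p) G (ZMod p)

variable {p G}

theorem IsDemushkin.exists_smul_sub (h : IsDemushkin p G) {x y : G × G → ZMod p}
    (hx : x ∈ Z2 (triv p G)) (hy : y ∈ Z2 (triv p G)) (hx' : ¬ IsCoboundary (triv p G) x) :
    ∃ t : ZMod p, IsCoboundary (triv p G) (y - t • x) := by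
  let X : H2 (triv p G) := Submodule.Quotient.mk ⟨x, hx⟩
  let Y : H2 (triv p G) := Submodule.Quotient.mk ⟨y, hy⟩
  have hX : X ≠ 0 := by
    rw [Ne, Submodule.Quotient.mk_eq_zero, mem_B2_iff]
    exact hx'
  obtain ⟨t, ht⟩ := (finrank_eq_one_iff_of_nonzero' X hX).1 h.finrank_H2 Y
  refine ⟨t, ?_⟩
  have : Submodule.Quotient.mk (p := B2 (triv p G)) ((⟨y, hy⟩ : Z2 (triv p G)) - t • ⟨x, hx⟩)
      = 0 := by
    rw [Submodule.Quotient.mk_sub, Submodule.Quotient.mk_smul]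
    exact sub_eq_zero.2 ht.symm
  rw [Submodule.Quotient.mk_eq_zero, mem_B2_iff] at this
  exact this

theorem IsDemushkin.eq_zero_of_cup (h : IsDemushkin p G) {a : G → ZMod p}
    (ha : a ∈ Z1 (triv p G))
    (hab : ∀ b ∈ Z1 (triv p G), IsCoboundary (triv p G) fun x => a x.1 * b x.2) : a = 0 := by
  have := h.left_kernel (Submodule.Quotient.mk ⟨a, ha⟩) (fun b => by
    obtain ⟨b, rfl⟩ := Submodule.Quotient.mk_surjective _ b
    change Submodule.Quotient.mk (p := B2 (triv p G)) (cupCocycle (ZMod p) G ⟨a, ha⟩ b) = 0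
    rw [Submodule.Quotient.mk_eq_zero, mem_B2_iff]
    exact hab b.1 b.2)
  rw [Submodule.Quotient.mk_eq_zero] at this
  exact congrArg Subtype.val (eq_zero_of_mem_B1_trivial this)

variable {W : Type*} [AddCommGroup W] [Module (ZMod p) W] {ρ : Representation (ZMod p) G W}

/-- Continuous `1`-cocycles with values in the dual of `W`. -/
structure IsDualCocycle (ρ : Representation (ZMod p) G W) (ε : G → Module.Dual (ZMod p) W) :
    Prop where
  locConst : IsLocallyConstant ε
  mul : ∀ g h w, ε (g * h) w = ε h w + ε g (ρ h w)

theorem IsDualCocycle.cup_mem {ε : G → Module.Dual (ZMod p) W} (hε : IsDualCocycle ρ ε)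
    {b : G → W} (hb : b ∈ Z1 ρ) : (fun x : G × G => ε x.1 (b x.2)) ∈ Z2 (triv p G) := by
  refine ⟨(hε.locConst.comp_continuous continuous_fst).comp₂
    (hb.1.comp_continuous continuous_snd) (fun a b => a b), fun g h l => ?_⟩
  simp only [hε.mul, hb.2, map_add, Representation.trivial_apply]
  abel

theorem IsDualCocycle.sub_smul {ε η : G → Module.Dual (ZMod p) W} (hε : IsDualCocycle ρ ε)
    (hη : IsDualCocycle ρ η) (t : ZMod p) : IsDualCocycle ρ (ε - t • η) := by
  refine ⟨hε.locConst.sub (hη.locConst.comp (fun x => t • x)), fun g h w => ?_⟩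
  simp only [Pi.sub_apply, Pi.smul_apply, LinearMap.sub_apply, LinearMap.smul_apply, hε.mul, hη.mul,
    smul_add]
  abel

/-- If `φ` takes the value `1` on a fixed vector `w`, this coboundary kills `w`. Its descent to `W /
⟨w⟩` represents the class of the extension of `W / ⟨w⟩` by the line, and is a coboundary there only
if the extension splits. -/
theorem isDualCocycle_sub_comp (hρ : IsLocallyConstant fun g => ρ g) (φ : Module.Dual (ZMod p) W) :
    IsDualCocycle ρ (fun g => φ - φ ∘ₗ ρ g) := by
  refine ⟨hρ.comp (fun x => φ - φ ∘ₗ x), fun g h w => ?_⟩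
  simp

theorem IsDualCocycle.descend {w : W} (S : Subrepresentation ρ)
    (hS : S.toSubmodule = Submodule.span (ZMod p) {w}) {ε : G → Module.Dual (ZMod p) W}
    (hε : IsDualCocycle ρ ε) (hw : ∀ g, ε g w = 0) :
    ∃ ε' : G → Module.Dual (ZMod p) (W ⧸ S.toSubmodule), IsDualCocycle (quot S) ε' ∧
      ∀ g v, ε' g (Submodule.Quotient.mk v) = ε g v := by
  have hle : ∀ g, S.toSubmodule ≤ LinearMap.ker (ε g) := fun g => by
    rw [hS, Submodule.span_le, Set.singleton_subset_iff]
    exact hw g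
  refine ⟨fun g => S.toSubmodule.liftQ (ε g) (hle g), ⟨?_, fun g h v => ?_⟩, fun g v => rfl⟩
  · refine IsLocallyConstant.desc _ (fun f => f ∘ₗ S.toSubmodule.mkQ) ?_ ?_
    · have : (fun f : Module.Dual (ZMod p) (W ⧸ S.toSubmodule) => f ∘ₗ S.toSubmodule.mkQ) ∘
          (fun g => S.toSubmodule.liftQ (ε g) (hle g)) = ε := by
        ext g v
        rfl
      rw [this]
      exact hε.locConst
    · intro a b hab
      exact Submodule.linearMap_qext _ hab
  · obtain ⟨v, rfl⟩ := Submodule.Quotient.mk_surjective _ v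
    exact hε.mul g h v

end Duality

/-! ### Duality for Demushkin groups with finite coefficients -/

section Duality

variable {p : ℕ} [Fact p.Prime] {G : Type*} [Group G] [TopologicalSpace G]

/-- A nonzero representation of a pro-`p` group has a fixed line. -/
theorem IsProP.exists_fixed_line (hG : IsProP p G) {W : Type*} [AddCommGroup W]
    [Module (ZMod p) W] [Module.Finite (ZMod p) W] [Nontrivial W] (ρ : Representation (ZMod p) G W)
    (hρ : IsOpen {g : G | ρ g = 1}) :
    ∃ (w : W) (S : Subrepresentation ρ) (φ : Module.Dual (ZMod p) W),
      (∀ g, ρ g w = w) ∧ S.toSubmodule = Submodule.span (ZMod p) {w} ∧ φ w = 1 ∧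
      Module.finrank (ZMod p) (W ⧸ S.toSubmodule) < Module.finrank (ZMod p) W := by
  have : Finite W := Module.finite_of_finite (ZMod p)
  obtain ⟨w, hw0, hw⟩ := hG.exists_fixed_ne_zero ρ hρ
  obtain ⟨φ, hφ⟩ := Module.Projective.exists_dual_eq_one (ZMod p) hw0
  refine ⟨w, ⟨Submodule.span (ZMod p) {w}, fun g v hv => ?_⟩, φ, hw, rfl, hφ, ?_⟩
  · obtain ⟨t, rfl⟩ := Submodule.mem_span_singleton.1 hv
    rw [map_smul, hw]
    exact hv
  · have h1 := Submodule.finrank_quotient_add_finrank (Submodule.span (ZMod p) {w})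
    rw [finrank_span_singleton hw0] at h1
    change Module.finrank (ZMod p) (W ⧸ Submodule.span (ZMod p) {w}) < _
    omega

variable {W : Type*} [AddCommGroup W] [Module (ZMod p) W] {ρ : Representation (ZMod p) G W}

omit [TopologicalSpace G] in
theorem exists_eq_smul_of_mk_eq_zero {w : W} {S : Subrepresentation ρ}
    (hS : S.toSubmodule = Submodule.span (ZMod p) {w}) {φ : Module.Dual (ZMod p) W} (hφ : φ w = 1)
    {v : W} (hv : Submodule.Quotient.mk (p := S.toSubmodule) v = 0) : v = φ v • w := by
  rw [Submodule.Quotient.mk_eq_zero, hS, Submodule.mem_span_singleton] at hv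
  obtain ⟨t, rfl⟩ := hv
  simp [hφ]

omit [TopologicalSpace G] in
theorem mk_d1 (S : Subrepresentation ρ) (c : G → W) (x : G × G) :
    Submodule.Quotient.mk (p := S.toSubmodule) (d1 ρ c x) =
      d1 (quot S) (fun g => Submodule.Quotient.mk (c g)) x := rfl

theorem isLocallyConstant_quot (hρ : IsLocallyConstant fun g => ρ g) (S : Subrepresentation ρ) :
    IsLocallyConstant fun g => quot S g := by
  rw [IsLocallyConstant.iff_eventually_eq] at hρ ⊢
  intro g
  filter_upwards [hρ g] with x hx
  ext v
  exact congrArg (fun f : W →ₗ[ZMod p] W => Submodule.Quotient.mk (p := S.toSubmodule) (f v)) hx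

/-- The connecting map for the extension of `W / ⟨w⟩` by the fixed line `⟨w⟩`. -/
theorem exists_lift_of_mem_Z1_quot {w : W} {S : Subrepresentation ρ}
    (hS : S.toSubmodule = Submodule.span (ZMod p) {w}) {φ : Module.Dual (ZMod p) W} (hφ : φ w = 1)
    {η : G → Module.Dual (ZMod p) (W ⧸ S.toSubmodule)}
    (hη : ∀ g v, η g (Submodule.Quotient.mk v) = φ v - φ (ρ g v))
    {b : G → W ⧸ S.toSubmodule} (hb : b ∈ Z1 (quot S)) :
    ∃ β : G → W, IsLocallyConstant β ∧ (∀ g, Submodule.Quotient.mk (β g) = b g) ∧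
      ∀ x, d1 ρ β x = -(η x.1 (b x.2)) • w := by
  let s := Function.surjInv (Submodule.Quotient.mk_surjective S.toSubmodule)
  have hs : ∀ y, Submodule.Quotient.mk (s y) = y :=
    Function.surjInv_eq (Submodule.Quotient.mk_surjective S.toSubmodule)
  have hmw : Submodule.Quotient.mk (p := S.toSubmodule) w = 0 := by
    rw [Submodule.Quotient.mk_eq_zero, hS]
    exact Submodule.mem_span_singleton_self w
  -- The lift is normalised so that `φ` vanishes on it. Only the term `φ (ρ g (β h))` then survives
  -- in `φ (d1 ρ β (g, h))`, and this is `-η g (b h)`.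
  have h1 : ∀ g, Submodule.Quotient.mk (s (b g) - φ (s (b g)) • w) = b g := fun g => by
    rw [Submodule.Quotient.mk_sub, Submodule.Quotient.mk_smul, hmw, smul_zero, sub_zero, hs]
  refine ⟨fun g => s (b g) - φ (s (b g)) • w, hb.1.comp (fun y => s y - φ (s y) • w), h1,
    fun x => ?_⟩
  have h2 := exists_eq_smul_of_mk_eq_zero hS hφ (v := d1 ρ (fun g => s (b g) - φ (s (b g)) • w) x)
    (by
      rw [mk_d1, funext h1, (d1_eq_zero_iff hb.1).2 hb]
      rfl)
  rw [h2]
  congr 1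
  rw [← h1 x.2, hη]
  have h3 : ∀ g, φ (s (b g) - φ (s (b g)) • w) = 0 := fun g => by simp [hφ]
  obtain ⟨g, h⟩ := x
  rw [d1_apply, map_add, map_sub, h3, h3, h3]
  ring

omit [TopologicalSpace G] in
theorem d1_smul_fixed {w : W} (hw : ∀ g, ρ g w = w) (c : G → ZMod p) (x : G × G) :
    d1 ρ (fun g => c g • w) x = d1 (triv p G) c x • w := by
  obtain ⟨g, h⟩ := x
  simp only [d1_apply, map_smul, hw, Representation.trivial_apply, add_smul, sub_smul]

variable [IsTopologicalGroup G]

/-- Nondegeneracy of the cup product with coefficients: a dual cocycle that is orthogonal to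
`H¹(G, W)` is a coboundary. -/
theorem IsDemushkin.exists_dual_coboundary (hD : IsDemushkin p G) (hG : IsProP p G) (n : ℕ) :
    ∀ {W : Type v} [AddCommGroup W] [Module (ZMod p) W] [Module.Finite (ZMod p) W]
      (ρ : Representation (ZMod p) G W), Module.finrank (ZMod p) W = n →
      IsOpen {g : G | ρ g = 1} → ∀ ε : G → Module.Dual (ZMod p) W, IsDualCocycle ρ ε →
      (∀ b ∈ Z1 ρ, IsCoboundary (triv p G) fun x => ε x.1 (b x.2)) →
      ∃ φ : Module.Dual (ZMod p) W, ∀ g w, ε g w = φ w - φ (ρ g w) := by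
  induction n using Nat.strong_induction_on with
  | _ n ih =>
    intro W _ _ _ ρ hn hρ ε hε hcup
    rcases subsingleton_or_nontrivial W with hW | hW
    · exact ⟨0, fun g w => by rw [Subsingleton.elim w 0]; simp⟩
    have hloc := isLocallyConstant_of_isOpen_ker hρ
    obtain ⟨w, S, φ₀, hw, hS, hφ₀, hlt⟩ := hG.exists_fixed_line ρ hρ
    -- For every character `b`, the cochain `b • w` is a cocycle in `W`, so `ε w ∪ b = 0`, and `ε w`
    -- lies in the left kernel.
    have hεw : ∀ g, ε g w = 0 := by
      have : (fun g => ε g w) = 0 := by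
        refine hD.eq_zero_of_cup ⟨hε.locConst.comp (fun f => f w), fun g h => ?_⟩ (fun b hb => ?_)
        · simp only [hε.mul, hw]
          rfl
        · have h1 := hcup (fun g => b g • w) ⟨hb.1.comp (fun t => t • w), fun g h => by
            simp only [hb.2, map_smul, hw, add_smul, Representation.trivial_apply]⟩
          convert h1 using 2 with x
          simp [mul_comm]
      exact fun g => congrFun this g
    obtain ⟨ε', hε', hεmk⟩ := hε.descend S hS hεw
    obtain ⟨η, hη, hηmk⟩ := (isDualCocycle_sub_comp hloc φ₀).descend S hS (fun g => by simp [hw])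
    have hηmk' : ∀ g v, η g (Submodule.Quotient.mk v) = φ₀ v - φ₀ (ρ g v) := hηmk
    -- Up to sign, `b ↦ η ∪ b` is the connecting map. Where it vanishes, `b` lifts to a cocycle in
    -- `W`, and the orthogonality of `ε` applies to that lift.
    have hker : ∀ b ∈ Z1 (quot S), IsCoboundary (triv p G) (fun x => η x.1 (b x.2)) →
        IsCoboundary (triv p G) (fun x => ε' x.1 (b x.2)) := by
      rintro b hb ⟨c, hc, hcb⟩
      obtain ⟨β, hβ, hβb, hdβ⟩ := exists_lift_of_mem_Z1_quot hS hφ₀ hηmk' hb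
      have hcl : IsLocallyConstant (β + fun g => c g • w) := hβ.add (hc.comp (fun t => t • w))
      have h1 : (β + fun g => c g • w) ∈ Z1 ρ := by
        rw [← d1_eq_zero_iff hcl]
        ext x
        rw [map_add, Pi.add_apply, hdβ, d1_smul_fixed hw, ← hcb, ← add_smul]
        simp
      convert hcup _ h1 using 2 with x
      rw [← hβb, hεmk]
      simp [hεw]
    -- Two linear maps from `H¹(G, W / ⟨w⟩)` to the line `H²(G, 𝔽_p)`, the kernel of `η` being
    -- contained in that of `ε'`: the second is a multiple of the first.
    have key : ∃ t : ZMod p, ∀ b ∈ Z1 (quot S),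
        IsCoboundary (triv p G) (fun x => (ε' - t • η) x.1 (b x.2)) := by
      by_cases hall : ∀ b ∈ Z1 (quot S), IsCoboundary (triv p G) (fun x => η x.1 (b x.2))
      · exact ⟨0, fun b hb => by simpa using hker b hb (hall b hb)⟩
      push Not at hall
      obtain ⟨b₀, hb₀, hnc⟩ := hall
      obtain ⟨t, ht⟩ := hD.exists_smul_sub (hη.cup_mem hb₀) (hε'.cup_mem hb₀) hnc
      refine ⟨t, fun b hb => ?_⟩
      obtain ⟨s, hs⟩ := hD.exists_smul_sub (hη.cup_mem hb₀) (hη.cup_mem hb) hnc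
      have hbs : b - s • b₀ ∈ Z1 (quot S) := Submodule.sub_mem _ hb (Submodule.smul_mem _ _ hb₀)
      have h1 := hker _ hbs (by
        convert hs using 1
        ext x
        simp)
      have h2 := (h1.add (ht.smul s)).sub (hs.smul t)
      convert h2 using 1
      ext x
      simp
      ring
    obtain ⟨t, ht⟩ := key
    obtain ⟨φ', hφ'⟩ := ih _ (hn ▸ hlt) (quot S) rfl
      (isOpen_ker (isLocallyConstant_quot hloc S)) _
      (hε'.sub_smul hη t) ht
    refine ⟨φ' ∘ₗ S.toSubmodule.mkQ + t • φ₀, fun g v => ?_⟩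
    have h3 := hφ' g (Submodule.Quotient.mk v)
    simp only [Pi.sub_apply, Pi.smul_apply, LinearMap.sub_apply, LinearMap.smul_apply, hεmk,
      hηmk'] at h3
    have h4 : quot S g (Submodule.Quotient.mk v) = Submodule.Quotient.mk (ρ g v) := rfl
    rw [h4] at h3
    simp only [LinearMap.add_apply, LinearMap.comp_apply, LinearMap.smul_apply,
      Submodule.mkQ_apply]
    rw [sub_eq_iff_eq_add] at h3
    rw [h3, smul_sub]
    ring

/-- A class in `H²(G, W)` vanishes if its images under all invariant functionals do. -/
theorem IsDemushkin.isCoboundary_of_functionals (hD : IsDemushkin p G) (hG : IsProP p G) (n : ℕ) :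
    ∀ {W : Type v} [AddCommGroup W] [Module (ZMod p) W] [Module.Finite (ZMod p) W]
      (ρ : Representation (ZMod p) G W), Module.finrank (ZMod p) W = n →
      IsOpen {g : G | ρ g = 1} → ∀ z ∈ Z2 ρ,
      (∀ f : Module.Dual (ZMod p) W, (∀ g w, f (ρ g w) = f w) →
        IsCoboundary (triv p G) fun x => f (z x)) → IsCoboundary ρ z := by
  induction n using Nat.strong_induction_on with
  | _ n ih =>
    intro W _ _ _ ρ hn hρ z hz hf
    rcases subsingleton_or_nontrivial W with hW | hW
    · rw [Subsingleton.elim z 0]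
      exact isCoboundary_zero
    have hloc := isLocallyConstant_of_isOpen_ker hρ
    obtain ⟨w, S, φ₀, hw, hS, hφ₀, hlt⟩ := hG.exists_fixed_line ρ hρ
    -- By induction the image of `z` in `W / ⟨w⟩` is a coboundary. Subtracting a lift of it leaves a
    -- cocycle `y` with values in the line.
    obtain ⟨c', hc', hzc'⟩ := ih _ (hn ▸ hlt) (quot S) rfl (isOpen_ker (isLocallyConstant_quot hloc S))
      (fun x => Submodule.Quotient.mk (z x))
      (map_mem_Z2 (σ := quot S) S.toSubmodule.mkQ.toAddMonoidHom (fun g m => rfl) hz)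
      (fun f hfinv => hf (f ∘ₗ S.toSubmodule.mkQ) fun g v => hfinv g (Submodule.Quotient.mk v))
    have hsurj := Submodule.Quotient.mk_surjective S.toSubmodule
    obtain ⟨c, hc, hcc'⟩ : ∃ c : G → W, IsLocallyConstant c ∧
        (fun g => Submodule.Quotient.mk (c g)) = c' :=
      ⟨fun g => Function.surjInv hsurj (c' g), hc'.comp (Function.surjInv hsurj),
        funext fun g => Function.surjInv_eq hsurj (c' g)⟩
    have hy2 : z - d1 ρ c ∈ Z2 ρ := Submodule.sub_mem _ hz (d1_mem_Z2 hloc hc)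
    have hyw : ∀ x, (z - d1 ρ c) x = φ₀ ((z - d1 ρ c) x) • w := fun x => by
      apply exists_eq_smul_of_mk_eq_zero hS hφ₀
      rw [Pi.sub_apply, Submodule.Quotient.mk_sub, mk_d1, hcc', ← hzc']
      exact sub_self _
    set y := z - d1 ρ c with hy
    have hz' : z = y + d1 ρ c := (sub_add_cancel _ _).symm
    suffices h : IsCoboundary ρ y from hz' ▸ h.add ⟨c, hc, rfl⟩
    have hcob : ∀ u : G × G → ZMod p, IsCoboundary (triv p G) u →
        IsCoboundary ρ (fun x => u x • w) := by
      rintro u ⟨e, he, rfl⟩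
      exact ⟨fun g => e g • w, he.comp (fun t => t • w), funext fun x => (d1_smul_fixed hw e x).symm⟩
    -- Either the fixed line is a direct summand, and the retraction `f` detects `y`, or the
    -- connecting map is onto `H²` of the line and `y` dies in `W`.
    by_cases hsplit : ∃ f : Module.Dual (ZMod p) W, (∀ g v, f (ρ g v) = f v) ∧ f w = 1
    · obtain ⟨f, hfinv, hfw⟩ := hsplit
      have h1 : IsCoboundary (triv p G) (fun x => f (y x)) := by
        have h2 := IsCoboundary.map (ρ := ρ) (σ := triv p G) f.toAddMonoidHom hfinv ⟨c, hc, rfl⟩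
        convert (hf f hfinv).sub h2 using 1
        ext x
        simp [hy]
      convert hcob _ h1 using 1
      ext x
      conv_lhs => rw [hyw]
      conv_rhs => rw [hyw, map_smul, hfw, smul_eq_mul, mul_one]
    · obtain ⟨η, hη, hηmk⟩ := (isDualCocycle_sub_comp hloc φ₀).descend S hS (fun g => by simp [hw])
      have hηmk' : ∀ g v, η g (Submodule.Quotient.mk v) = φ₀ v - φ₀ (ρ g v) := hηmk
      -- If all products vanished, `η` would be the coboundary of some `φ` by nondegeneracy, and `φ₀
      -- - φ` would be an invariant functional with value `1` at `w`.
      have hex : ∃ b ∈ Z1 (quot S), ¬ IsCoboundary (triv p G) fun x => η x.1 (b x.2) := by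
        by_contra! hcon
        obtain ⟨φ, hφ⟩ := hD.exists_dual_coboundary hG _ (quot S) rfl
          (isOpen_ker (isLocallyConstant_quot hloc S)) η hη hcon
        refine hsplit ⟨φ₀ - φ ∘ₗ S.toSubmodule.mkQ, fun g v => ?_, ?_⟩
        · have h1 := hφ g (Submodule.Quotient.mk v)
          have h2 : quot S g (Submodule.Quotient.mk v) = Submodule.Quotient.mk (ρ g v) := rfl
          rw [hηmk', h2] at h1
          simp only [LinearMap.sub_apply, LinearMap.comp_apply, Submodule.mkQ_apply]
          linear_combination -h1
        · have hmw : Submodule.Quotient.mk (p := S.toSubmodule) w = 0 := by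
            rw [Submodule.Quotient.mk_eq_zero, hS]
            exact Submodule.mem_span_singleton_self w
          simp [hmw, hφ₀]
      obtain ⟨b, hb, hnc⟩ := hex
      have hY2 : (fun x => φ₀ (y x)) ∈ Z2 (triv p G) := by
        refine ⟨hy2.1.comp φ₀, fun g h l => ?_⟩
        have h1 := hy2.2 g h l
        rw [hyw (h, l), map_smul, hw, ← hyw] at h1
        simp only [Representation.trivial_apply, ← map_add, h1]
      obtain ⟨t, ht⟩ := hD.exists_smul_sub (hη.cup_mem hb) hY2 hnc
      obtain ⟨β, hβ, -, hdβ⟩ := exists_lift_of_mem_Z1_quot hS hφ₀ hηmk' hb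
      convert (hcob _ ht).sub (IsCoboundary.smul t ⟨β, hβ, rfl⟩) using 1
      ext x
      conv_lhs => rw [hyw]
      simp [hdβ, sub_smul, mul_smul]

end Duality

/-! ### Divisibility in free modules over `ℤ/p^r` -/

section PrimePower

variable {p r : ℕ}

/-- The reduction `ℤ/p^r → ℤ/p`. -/
def redP (p : ℕ) {r : ℕ} (hr : r ≠ 0) : ZMod (p ^ r) →+* ZMod p :=
  ZMod.castHom (dvd_pow_self p hr) (ZMod p)

theorem natCast_pow_eq_zero : (p : ZMod (p ^ r)) ^ r = 0 := by
  rw [← Nat.cast_pow]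
  exact ZMod.natCast_self _

theorem redP_natCast (hr : r ≠ 0) (n : ℕ) : redP p hr n = n := map_natCast _ n

theorem redP_surjective (hr : r ≠ 0) : Function.Surjective (redP p hr) :=
  ZMod.ringHom_surjective _

variable [Fact p.Prime]

instance : NeZero (p ^ r) := ⟨pow_ne_zero _ (Fact.out : p.Prime).ne_zero⟩

theorem redP_eq_zero_iff (hr : r ≠ 0) (x : ZMod (p ^ r)) : redP p hr x = 0 ↔ ∃ y, x = p * y := by
  constructor
  · intro h
    rw [← ZMod.natCast_zmod_val x, redP_natCast, ZMod.natCast_eq_zero_iff] at h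
    obtain ⟨y, hy⟩ := h
    exact ⟨y, by rw [← ZMod.natCast_zmod_val x, hy, Nat.cast_mul]⟩
  · rintro ⟨y, rfl⟩
    rw [map_mul, redP_natCast, ZMod.natCast_self, zero_mul]

theorem exists_eq_pow_mul {j : ℕ} (hj : j ≤ r) {x : ZMod (p ^ r)}
    (hx : (p : ZMod (p ^ r)) ^ j * x = 0) : ∃ y, x = (p : ZMod (p ^ r)) ^ (r - j) * y := by
  rw [← ZMod.natCast_zmod_val x, ← Nat.cast_pow, ← Nat.cast_mul, ZMod.natCast_eq_zero_iff] at hx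
  have h1 : p ^ j * p ^ (r - j) ∣ p ^ j * x.val := by rwa [← pow_add, Nat.add_sub_cancel' hj]
  obtain ⟨y, hy⟩ := Nat.dvd_of_mul_dvd_mul_left (pow_pos (Fact.out : p.Prime).pos j) h1
  exact ⟨y, by rw [← ZMod.natCast_zmod_val x, hy, Nat.cast_mul, Nat.cast_pow]⟩

variable {V : Type*} [AddCommGroup V] [Module (ZMod (p ^ r)) V]

theorem exists_eq_pow_smul [Module.Free (ZMod (p ^ r)) V] [Module.Finite (ZMod (p ^ r)) V]
    {j : ℕ} (hj : j ≤ r) {v : V} (hv : (p : ZMod (p ^ r)) ^ j • v = 0) :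
    ∃ v', v = (p : ZMod (p ^ r)) ^ (r - j) • v' := by
  let b := Module.Free.chooseBasis (ZMod (p ^ r)) V
  have h (i) : ∃ y, b.equivFun v i = (p : ZMod (p ^ r)) ^ (r - j) * y := by
    apply exists_eq_pow_mul hj
    have := congrFun (congrArg b.equivFun hv) i
    rwa [map_smul, map_zero] at this
  choose y hy using h
  refine ⟨b.equivFun.symm y, b.equivFun.injective ?_⟩
  rw [map_smul, LinearEquiv.apply_symm_apply]
  exact funext hy

/-- Elements of `p V` on which a surjection onto a free module vanishes are `p`-multiples of
elements on which it vanishes. -/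
theorem exists_eq_smul_of_apply_eq_zero (hr : r ≠ 0) {ι : Type*} [Finite ι]
    {φ : V →ₗ[ZMod (p ^ r)] ι → ZMod (p ^ r)} (hφ : Function.Surjective φ) {v v' : V}
    (hv : φ v = 0) (hv' : v = (p : ZMod (p ^ r)) • v') :
    ∃ w, v = (p : ZMod (p ^ r)) • w ∧ φ w = 0 := by
  have h1 : (p : ZMod (p ^ r)) ^ 1 • φ v' = 0 := by rw [pow_one, ← map_smul, ← hv', hv]
  obtain ⟨t, ht⟩ := exists_eq_pow_smul (Nat.one_le_iff_ne_zero.2 hr) h1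
  obtain ⟨u, rfl⟩ := hφ t
  refine ⟨v' - (p : ZMod (p ^ r)) ^ (r - 1) • u, ?_, ?_⟩
  · rw [smul_sub, smul_smul, ← pow_succ', Nat.sub_add_cancel (Nat.one_le_iff_ne_zero.2 hr),
      natCast_pow_eq_zero, zero_smul, sub_zero, hv']
  · rw [map_sub, map_smul, ht, sub_self]

end PrimePower

/-! ### Lifting cocycles from `V/p` to `V` -/

section Lifting

variable {p r : ℕ} [Fact p.Prime] {G : Type*} [Group G] [TopologicalSpace G]

/-- `π : V → W` presents the representation `W` over `𝔽_p` as the reduction of `V` modulo `p`. -/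
structure IsReduction {V W : Type*} [AddCommGroup V] [Module (ZMod (p ^ r)) V] [AddCommGroup W]
    [Module (ZMod p) W] (ρ : Representation (ZMod (p ^ r)) G V) (σ : Representation (ZMod p) G W)
    (π : V →+ W) : Prop where
  surjective : Function.Surjective π
  map_apply : ∀ g v, π (ρ g v) = σ g (π v)
  eq_zero_iff : ∀ v, π v = 0 ↔ ∃ v', v = (p : ZMod (p ^ r)) • v'

variable (p r G) in
/-- Characters with values in `ℤ/p` lift to `ℤ/p^r`. -/
def LiftsCharacters (hr : r ≠ 0) : Prop :=
  ∀ a ∈ Z1 (triv p G), ∃ b ∈ Z1 (Representation.trivial (ZMod (p ^ r)) G (ZMod (p ^ r))),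
    ∀ g, redP p hr (b g) = a g

variable {V : Type*} [AddCommGroup V] [Module (ZMod (p ^ r)) V]
  {ρ : Representation (ZMod (p ^ r)) G V} {W : Type v} [AddCommGroup W] [Module (ZMod p) W]
  {σ : Representation (ZMod p) G W} {π : V →+ W} {ι : Type*}
  {φ : V →ₗ[ZMod (p ^ r)] ι → ZMod (p ^ r)}

/-- A cochain whose coboundary is divisible by `p` can be modified by a `p`-multiple, so that
its images under invariant functionals become cocycles. -/
theorem exists_adjust (hr : r ≠ 0) (hH90 : LiftsCharacters p r G hr) [Finite ι]
    (hφ : Function.Surjective φ) (hφρ : ∀ g v, φ (ρ g v) = φ v) {c : G → V}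
    (hc : IsLocallyConstant c) (hdc : ∀ x i, redP p hr (φ (d1 ρ c x) i) = 0) :
    ∃ e : G → V, IsLocallyConstant e ∧
      ∀ x, φ (d1 ρ (c + (p : ZMod (p ^ r)) • e) x) = 0 := by
  -- By invariance of `φ`, the coboundary of `φ ∘ c` is taken with trivial coefficients. It vanishes
  -- modulo `p`, so each coordinate of `φ ∘ c` is modulo `p` a character, and this character lifts.
  have key : ∀ i, ∃ b ∈ Z1 (Representation.trivial (ZMod (p ^ r)) G (ZMod (p ^ r))),
      ∀ g, redP p hr (b g) = redP p hr (φ (c g) i) := fun i => by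
    apply hH90 (fun g => redP p hr (φ (c g) i))
    refine (d1_eq_zero_iff (hc.comp (fun v => redP p hr (φ v i)))).1 ?_
    ext ⟨g, h⟩
    have := hdc (g, h) i
    simpa [d1_apply, hφρ] using this
  choose b hb hbc using key
  have h2 : ∀ y : ZMod (p ^ r), ∃ t, redP p hr y = 0 → y = p * t := fun y => by
    by_cases h : redP p hr y = 0
    · obtain ⟨t, ht⟩ := (redP_eq_zero_iff hr y).1 h
      exact ⟨t, fun _ => ht⟩
    · exact ⟨0, fun h' => absurd h' h⟩
  choose t ht using h2
  have hbl : IsLocallyConstant fun g => fun i => b i g := by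
    have := Fintype.ofFinite ι
    rw [IsLocallyConstant.iff_eventually_eq]
    intro g
    have := fun i => (hb i).1.eventually_eq g
    filter_upwards [Filter.eventually_all.2 this] with y hy
    exact funext hy
  let s := Function.surjInv hφ
  have hs : ∀ y, φ (s y) = y := Function.surjInv_eq hφ
  -- Here `t` divides by `p`, so this choice makes `φ (c + p e)` equal to the lifted characters `b`,
  -- whose coboundary is zero.
  refine ⟨fun g => s fun i => t (b i g - φ (c g) i),
    hbl.comp₂ hc (fun x v => s fun i => t (x i - φ v i)), ?_⟩
  have h3 : ∀ g, φ ((c + (p : ZMod (p ^ r)) • fun g => s fun i => t (b i g - φ (c g) i)) g) =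
      fun i => b i g := fun g => by
    ext i
    rw [Pi.add_apply, Pi.smul_apply, map_add, map_smul, hs]
    simp only [Pi.add_apply, Pi.smul_apply, smul_eq_mul]
    rw [← ht (b i g - φ (c g) i) (by rw [map_sub, hbc, sub_self])]
    ring
  rintro ⟨g, h⟩
  rw [d1_apply, map_add, map_sub, hφρ, h3, h3, h3]
  ext i
  have := (hb i).2 g h
  simp only [Representation.trivial_apply] at this
  simp [this]

-- Division by `p` is a function chosen once on `V` and composed with `y`, which keeps local
-- constancy. The quotient can be kept in the kernel of `φ` because `φ` is onto a free module.
omit [TopologicalSpace G] in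
theorem exists_divide [Finite ι] (hφ : Function.Surjective φ) (hr : r ≠ 0) (hπ : IsReduction ρ σ π) {X : Type*} [TopologicalSpace X]
    {y : X → V} (hy : IsLocallyConstant y) (h1 : ∀ x, φ (y x) = 0) (h2 : ∀ x, π (y x) = 0) :
    ∃ z : X → V, IsLocallyConstant z ∧ (∀ x, φ (z x) = 0) ∧ y = (p : ZMod (p ^ r)) • z := by
  have key : ∀ v, ∃ w, φ v = 0 → π v = 0 → v = (p : ZMod (p ^ r)) • w ∧ φ w = 0 := fun v => by
    by_cases h : φ v = 0 ∧ π v = 0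
    · obtain ⟨v', hv'⟩ := (hπ.eq_zero_iff v).1 h.2
      obtain ⟨w, hw⟩ := exists_eq_smul_of_apply_eq_zero hr hφ h.1 hv'
      exact ⟨w, fun _ _ => hw⟩
    · exact ⟨0, fun h3 h4 => absurd ⟨h3, h4⟩ h⟩
  choose d hd using key
  exact ⟨fun x => d (y x), hy.comp d, fun x => (hd _ (h1 x) (h2 x)).2,
    funext fun x => (hd _ (h1 x) (h2 x)).1⟩

omit [TopologicalSpace G] in
theorem redP_eq_zero_of_map_eq_zero (hπ : IsReduction ρ σ π) (hr : r ≠ 0) (φ : V →ₗ[ZMod (p ^ r)] ι → ZMod (p ^ r)) {v : V}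
    (hv : π v = 0) (i : ι) : redP p hr (φ v i) = 0 := by
  obtain ⟨v', rfl⟩ := (hπ.eq_zero_iff v).1 hv
  rw [map_smul, redP_eq_zero_iff]
  exact ⟨φ v' i, rfl⟩

variable [IsTopologicalGroup G]

omit [IsTopologicalGroup G] in
theorem IsReduction.isLocallyConstant (hπ : IsReduction ρ σ π) (hρ : IsLocallyConstant fun g => ρ g) :
    IsLocallyConstant fun g => σ g := by
  rw [IsLocallyConstant.iff_eventually_eq] at hρ ⊢
  intro g
  filter_upwards [hρ g] with x hx
  ext w
  obtain ⟨v, rfl⟩ := hπ.surjective w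
  rw [← hπ.map_apply, ← hπ.map_apply, hx]

section

variable (hr : r ≠ 0) (hH90 : LiftsCharacters p r G hr) (hD : IsDemushkin p G) (hG : IsProP p G)
  [Finite ι] [Module.Free (ZMod (p ^ r)) V] [Module.Finite (ZMod (p ^ r)) V]
  [Module.Finite (ZMod p) W] (hρ : IsLocallyConstant fun g => ρ g) (hπ : IsReduction ρ σ π)
  (hφ : Function.Surjective φ) (hφρ : ∀ g v, φ (ρ g v) = φ v)
  (hφπ : ∀ f : Module.Dual (ZMod p) W, (∀ g w, f (σ g w) = f w) → ∀ v, φ v = 0 → f (π v) = 0)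

-- Descending induction on `j`: modulo `p` the cochain `y` is a cocycle killed by all invariant
-- functionals, hence a coboundary by duality. Removing a lift of it makes `y` divisible by `p`,
-- with quotient still in the kernel of `φ`. At `j = r` everything is zero.
include hH90 hD hG hρ hπ hφ hφρ hφπ in
theorem exists_coboundary_of_pow_smul (m : ℕ) : ∀ j, j + m = r → ∀ y : G × G → V,
    IsLocallyConstant y → (∀ x, φ (y x) = 0) → (p : ZMod (p ^ r)) ^ j • y ∈ Z2 ρ →
    ∃ c : G → V, IsLocallyConstant c ∧ (p : ZMod (p ^ r)) ^ j • y =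
      d1 ρ ((p : ZMod (p ^ r)) ^ j • c) := by
  induction m with
  | zero =>
    intro j hj y _ _ _
    have h0 : (p : ZMod (p ^ r)) ^ j = 0 := by
      rw [show j = r by omega]
      exact natCast_pow_eq_zero
    exact ⟨0, IsLocallyConstant.const 0, by rw [h0, zero_smul, zero_smul, map_zero]⟩
  | succ m ih =>
    intro j hj y hy hφy hy2
    -- The cocycle defect of `y` is killed by `p ^ j`, hence divisible by `p ^ (r - j)`. Since `j <
    -- r`, it vanishes modulo `p`.
    have hπy : (fun x => π (y x)) ∈ Z2 σ := by
      refine ⟨hy.comp π, fun g h l => ?_⟩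
      rw [← hπ.map_apply, ← map_add, ← map_add, ← sub_eq_zero, ← map_sub, hπ.eq_zero_iff]
      have h1 := hy2.2 g h l
      simp only [Pi.smul_apply, map_smul, ← smul_add] at h1
      rw [← sub_eq_zero, ← smul_sub] at h1
      obtain ⟨v', hv'⟩ := exists_eq_pow_smul (by omega) h1
      refine ⟨(p : ZMod (p ^ r)) ^ m • v', ?_⟩
      rw [hv', smul_smul, ← pow_succ', show r - j = m + 1 by omega]
    obtain ⟨c₀, hc₀, hyc₀⟩ := hD.isCoboundary_of_functionals hG _ σ rfl
      (isOpen_ker (hπ.isLocallyConstant hρ)) _ hπy (fun f hf => by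
        convert isCoboundary_zero using 1
        ext x
        exact hφπ f hf _ (hφy x))
    let s := Function.surjInv hπ.surjective
    have hs : ∀ w, π (s w) = w := Function.surjInv_eq hπ.surjective
    have hsl : IsLocallyConstant fun g => s (c₀ g) := hc₀.comp s
    have h3 : ∀ x, π (d1 ρ (fun g => s (c₀ g)) x) = π (y x) := fun x => by
      have := congrFun (map_d1 (σ := σ) π hπ.map_apply (fun g => s (c₀ g))) x
      simp only [hs] at this
      rw [this, ← hyc₀]
    -- The lift of `c₀` is corrected by a multiple of `p`, so that its coboundary lies in the kernel
    -- of `φ` and subtracting it from `y` keeps the induction hypothesis.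
    obtain ⟨e, he, hφe⟩ := exists_adjust hr hH90 hφ hφρ hsl (fun x i => by
      have := redP_eq_zero_of_map_eq_zero hπ hr φ (v := d1 ρ (fun g => s (c₀ g)) x - y x)
        (by rw [map_sub, h3, sub_self]) i
      rwa [map_sub, hφy, sub_zero] at this)
    set c := (fun g => s (c₀ g)) + (p : ZMod (p ^ r)) • e with hcdef
    have hc : IsLocallyConstant c := hsl.add (he.comp (fun v => (p : ZMod (p ^ r)) • v))
    have hπc : ∀ x, π (d1 ρ c x) = π (y x) := fun x => by
      rw [hcdef, map_add, map_smul, Pi.add_apply, map_add, h3, add_eq_left, hπ.eq_zero_iff]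
      exact ⟨_, rfl⟩
    obtain ⟨z, hz, hφz, hyz⟩ := exists_divide hφ hr hπ (y := y - d1 ρ c)
      (hy.sub (isLocallyConstant_d1 hρ hc))
      (fun x => by rw [Pi.sub_apply, map_sub, hφe, hφy, sub_zero])
      (fun x => by rw [Pi.sub_apply, map_sub, hπc, sub_self])
    have hpz : (p : ZMod (p ^ r)) ^ (j + 1) • z =
        (p : ZMod (p ^ r)) ^ j • y - d1 ρ ((p : ZMod (p ^ r)) ^ j • c) := by
      rw [pow_succ, mul_smul, ← hyz, smul_sub, map_smul]
    obtain ⟨c', hc', hzc'⟩ := ih (j + 1) (by omega) z hz hφz (by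
      rw [hpz]
      exact Submodule.sub_mem _ hy2 (d1_mem_Z2 hρ (hc.comp (fun v => (p : ZMod (p ^ r)) ^ j • v))))
    refine ⟨c + (p : ZMod (p ^ r)) • c', hc.add (hc'.comp (fun v => (p : ZMod (p ^ r)) • v)), ?_⟩
    rw [smul_add, map_add, smul_smul, ← pow_succ, ← hzc', hpz]
    abel

include hH90 hD hG hρ hπ hφ hφρ hφπ in
/-- If all invariant functionals on the reduction `W` of `V` come from invariant functionals on
`V`, then cocycles with values in `W` lift to `V`. -/
theorem IsReduction.exists_lift_Z1 {c : G → W} (hc : c ∈ Z1 σ) :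
    ∃ b ∈ Z1 ρ, ∀ g, π (b g) = c g := by
  let s := Function.surjInv hπ.surjective
  have hs : ∀ w, π (s w) = w := Function.surjInv_eq hπ.surjective
  have hsl : IsLocallyConstant fun g => s (c g) := hc.1.comp s
  have h3 : ∀ x, π (d1 ρ (fun g => s (c g)) x) = 0 := fun x => by
    have := congrFun (map_d1 (σ := σ) π hπ.map_apply (fun g => s (c g))) x
    simp only [hs] at this
    rw [this, (d1_eq_zero_iff hc.1).2 hc]
    rfl
  obtain ⟨e, he, hφe⟩ := exists_adjust hr hH90 hφ hφρ hsl
    (fun x i => redP_eq_zero_of_map_eq_zero hπ hr φ (h3 x) i)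
  set b := (fun g => s (c g)) + (p : ZMod (p ^ r)) • e with hbdef
  have hb : IsLocallyConstant b := hsl.add (he.comp (fun v => (p : ZMod (p ^ r)) • v))
  have hπp : ∀ v, π ((p : ZMod (p ^ r)) • v) = 0 := fun v => (hπ.eq_zero_iff _).2 ⟨v, rfl⟩
  obtain ⟨z, hz, hφz, hyz⟩ := exists_divide hφ hr hπ (isLocallyConstant_d1 hρ hb) hφe (fun x => by
    rw [hbdef, map_add, map_smul, Pi.add_apply, map_add, h3, zero_add, Pi.smul_apply, hπp])
  -- The obstruction `d1 ρ b = p z` is the coboundary of a cochain divisible by `p`, so removing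
  -- that cochain from `b` does not change its reduction.
  obtain ⟨c', hc', hzc'⟩ := exists_coboundary_of_pow_smul hr hH90 hD hG hρ hπ hφ hφρ hφπ (r - 1) 1
    (by omega) z hz hφz (by rw [pow_one, ← hyz]; exact d1_mem_Z2 hρ hb)
  rw [pow_one, ← hyz] at hzc'
  have hl : IsLocallyConstant (b - (p : ZMod (p ^ r)) • c') :=
    hb.sub (hc'.comp (fun v => (p : ZMod (p ^ r)) • v))
  refine ⟨b - (p : ZMod (p ^ r)) • c', ?_, fun g => ?_⟩
  · rw [← d1_eq_zero_iff hl, map_sub, ← hzc', sub_self]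
  · rw [Pi.sub_apply, map_sub, Pi.smul_apply, hπp, sub_zero, hbdef, Pi.add_apply, map_add,
      Pi.smul_apply, hπp, add_zero, hs]

end

end Lifting

/-! ### From a pro-`p`-Sylow subgroup to the whole group -/

section Transfer

variable {k k' G V W : Type*} [CommRing k] [CommRing k'] [Group G] [TopologicalSpace G]
  [AddCommGroup V] [Module k V] [AddCommGroup W] [Module k' W]

/-- By the cocycle relation, vanishing on a neighbourhood `N` of `1` makes `b` constant on each `g
N`. -/
theorem isLocallyConstant_of_cocycle [IsTopologicalGroup G] {ρ : Representation k G V} {b : G → V}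
    (hb : ∀ g h, b (g * h) = ρ g (b h) + b g) {N : Set G} (hN : N ∈ nhds 1)
    (hbN : ∀ n ∈ N, b n = 0) : IsLocallyConstant b := by
  rw [IsLocallyConstant.iff_eventually_eq]
  intro g
  have h1 : (fun x => g⁻¹ * x) ⁻¹' N ∈ nhds g := by
    refine (continuous_const_mul g⁻¹).continuousAt.preimage_mem_nhds ?_
    rwa [inv_mul_cancel]
  filter_upwards [h1] with x hx
  have := hb g (g⁻¹ * x)
  rwa [mul_inv_cancel_left, hbN _ hx, map_zero, zero_add] at this

theorem apply_one_of_mem_Z1 {ρ : Representation k G V} {b : G → V} (hb : b ∈ Z1 ρ) : b 1 = 0 := by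
  have := hb.2 1 1
  rw [mul_one, map_one, Module.End.one_apply] at this
  simpa using this

omit [TopologicalSpace G] in
/-- Corestriction of a cocycle from a subgroup of finite index. -/
theorem exists_corestriction {ρ : Representation k G V} {σ : Representation k' G W} {π : V →+ W}
    (hπ : ∀ g v, π (ρ g v) = σ g (π v)) {U N : Subgroup G} [Finite (G ⧸ U)] [N.Normal]
    (hNU : N ≤ U) {f : G → V} (hf : ∀ g ∈ U, ∀ h ∈ U, f (g * h) = ρ g (f h) + f g)
    (hfN : ∀ n ∈ N, f n = 0) {c : G → W} (hc : ∀ g h, c (g * h) = σ g (c h) + c g)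
    (hfc : ∀ g ∈ U, π (f g) = c g) :
    ∃ (F : G → V) (w : W), (∀ g h, F (g * h) = ρ g (F h) + F g) ∧ (∀ n ∈ N, F n = 0) ∧
      ∀ g, π (F g) = U.index • c g + (σ g w - w) := by
  have := Fintype.ofFinite (G ⧸ U)
  have hout : ∀ (g : G) (x : G ⧸ U), (g • x).out⁻¹ * (g * x.out) ∈ U := fun g x => by
    rw [← QuotientGroup.eq, QuotientGroup.out_eq', ← smul_eq_mul, ← MulAction.Quotient.smul_mk,
      QuotientGroup.out_eq']
  -- The usual transfer formula on coset representatives. The coboundary in the last clause measures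
  -- the dependence on representatives and comes from the sum of `c` over them.
  refine ⟨fun g => ∑ x : G ⧸ U, ρ (g • x).out (f ((g • x).out⁻¹ * (g * x.out))),
    ∑ x : G ⧸ U, c x.out, fun g h => ?_, fun n hn => ?_, fun g => ?_⟩
  · have h1 : ∀ x : G ⧸ U, ρ ((g * h) • x).out (f (((g * h) • x).out⁻¹ * (g * h * x.out))) =
        ρ g (ρ (h • x).out (f ((h • x).out⁻¹ * (h * x.out)))) +
          ρ (g • h • x).out (f ((g • h • x).out⁻¹ * (g * (h • x).out))) := fun x => by
      have h2 : ((g * h) • x).out⁻¹ * (g * h * x.out) =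
          ((g • h • x).out⁻¹ * (g * (h • x).out)) * ((h • x).out⁻¹ * (h * x.out)) := by
        rw [mul_smul]
        group
      rw [h2, hf _ (hout g (h • x)) _ (hout h x), map_add, mul_smul]
      congr 1
      rw [← Module.End.mul_apply, ← Module.End.mul_apply, ← map_mul, ← map_mul, mul_inv_cancel_left]
    refine (Finset.sum_congr rfl fun x _ => h1 x).trans ?_
    rw [Finset.sum_add_distrib, map_sum]
    congr 1
    exact (MulAction.bijective h).sum_comp
      (fun x : G ⧸ U => ρ (g • x).out (f ((g • x).out⁻¹ * (g * x.out))))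
  · refine Finset.sum_eq_zero fun x _ => ?_
    have h1 : n • x = x := by
      conv_lhs => rw [← QuotientGroup.out_eq' x]
      conv_rhs => rw [← QuotientGroup.out_eq' x]
      rw [MulAction.Quotient.smul_mk, smul_eq_mul, eq_comm, QuotientGroup.eq]
      have := Subgroup.Normal.conj_mem ‹N.Normal› n hn x.out⁻¹
      rw [inv_inv, mul_assoc] at this
      exact hNU this
    rw [h1, hfN, map_zero]
    have := Subgroup.Normal.conj_mem ‹N.Normal› n hn x.out⁻¹
    rwa [inv_inv, mul_assoc] at this
  · rw [map_sum]
    have h1 : ∀ x : G ⧸ U, π (ρ (g • x).out (f ((g • x).out⁻¹ * (g * x.out)))) =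
        c g + (σ g (c x.out) - c (g • x).out) := fun x => by
      rw [hπ, hfc _ (hout g x)]
      have h2 := hc (g • x).out ((g • x).out⁻¹ * (g * x.out))
      rw [mul_inv_cancel_left, hc] at h2
      rw [eq_sub_of_add_eq h2.symm]
      abel
    rw [Finset.sum_congr rfl fun x _ => h1 x, Finset.sum_add_distrib, Finset.sum_sub_distrib,
      Finset.sum_const, Finset.card_univ, ← Nat.card_eq_fintype_card, map_sum]
    congr 2
    exact (MulAction.bijective g).sum_comp (fun x : G ⧸ U => c x.out)

omit [TopologicalSpace G] in
/-- Extension of a cocycle on `P` to `P N`, when `N` acts trivially and the cocycle vanishes on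
`P ∩ N`. -/
theorem exists_extend_cocycle {ρ : Representation k G V} {P N : Subgroup G} [N.Normal]
    (hN : ∀ n ∈ N, ρ n = 1) {b : P → V} (hb : ∀ g h, b (g * h) = ρ g (b h) + b g)
    (hbN : ∀ x : P, (x : G) ∈ N → b x = 0) :
    ∃ f : G → V, (∀ g ∈ P ⊔ N, ∀ h ∈ P ⊔ N, f (g * h) = ρ g (f h) + f g) ∧
      (∀ n ∈ N, f n = 0) ∧ ∀ g ∈ P ⊔ N, ∃ x : P, (x : G)⁻¹ * g ∈ N ∧ f g = b x := by
  -- A cocycle vanishing on `P ∩ N` depends only on classes modulo `N`, so it can be read on `P N /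
  -- N`.
  have hwd : ∀ x y : P, (x : G ⧸ N) = (y : G) → b x = b y := fun x y hxy => by
    have h1 := hb x (x⁻¹ * y)
    rw [mul_inv_cancel_left, hbN (x⁻¹ * y) (by simpa using QuotientGroup.eq.1 hxy), map_zero,
      zero_add] at h1
    exact h1.symm
  have hex : ∀ g : G, ∃ x : P, g ∈ P ⊔ N → (x : G ⧸ N) = g := fun g => by
    by_cases hg : g ∈ P ⊔ N
    · rw [← SetLike.mem_coe, Subgroup.mul_normal] at hg
      obtain ⟨x, hx, n, hn, rfl⟩ := hg
      exact ⟨⟨x, hx⟩, fun _ => QuotientGroup.eq.2 (by simpa using hn)⟩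
    · exact ⟨1, fun h => absurd h hg⟩
  choose s hs using hex
  have hρ : ∀ g ∈ P ⊔ N, ρ g = ρ (s g) := fun g hg => by
    have h1 := hN _ (QuotientGroup.eq.1 (hs g hg))
    have h2 : ρ ((s g : G) * ((s g : G)⁻¹ * g)) = ρ (s g) := by rw [map_mul, h1, mul_one]
    rwa [mul_inv_cancel_left] at h2
  refine ⟨fun g => b (s g), fun g hg h hh => ?_, fun n hn => ?_,
    fun g hg => ⟨s g, QuotientGroup.eq.1 (hs g hg), rfl⟩⟩
  · rw [hρ g hg, ← hb]
    apply hwd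
    rw [hs _ (mul_mem hg hh), QuotientGroup.mk_mul, ← hs g hg, ← hs h hh]
    rfl
  · apply hbN
    have := hs n (Subgroup.mem_sup_right hn)
    rwa [(QuotientGroup.eq_one_iff n).2 hn, QuotientGroup.eq_one_iff] at this

/-- If cocycles with values in `W` lift to `V` over a pro-`p`-Sylow subgroup, they do so over the
whole group. -/
theorem IsProPSylow.exists_lift_Z1 [IsTopologicalGroup G] [CompactSpace G] [T2Space G]
    [TotallyDisconnectedSpace G] {p : ℕ} [Fact p.Prime] {P : Subgroup G} (hP : IsProPSylow p P)
    {ρ : Representation k G V} {σ : Representation k' G W} {π : V →+ W}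
    (hπs : Function.Surjective π) (hπ : ∀ g v, π (ρ g v) = σ g (π v))
    (hρ : IsOpen {g : G | ρ g = 1}) (hW : ∀ w : W, p • w = 0)
    (hlift : ∀ c ∈ Z1 (σ.comp P.subtype), ∃ b ∈ Z1 (ρ.comp P.subtype), ∀ g, π (b g) = c g)
    {c : G → W} (hc : c ∈ Z1 σ) : ∃ b ∈ Z1 ρ, ∀ g, π (b g) = c g := by
  obtain ⟨b, hb, hbc⟩ := hlift (fun g => c g)
    ⟨hc.1.comp_continuous continuous_subtype_val, fun g h => hc.2 g h⟩
  obtain ⟨B, hBo, hB⟩ : ∃ B : Set G, IsOpen B ∧ Subtype.val ⁻¹' B = {x : P | b x = 0} :=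
    isOpen_induced_iff.1 (hb.1.isOpen_fiber 0)
  have h1B : (1 : G) ∈ B := by
    have : (1 : P) ∈ {x : P | b x = 0} := apply_one_of_mem_Z1 hb
    rw [← hB] at this
    exact this
  -- `P` may have infinite index, so it is replaced by the open subgroup `P N`. Here `N` acts
  -- trivially on `V`, `c` vanishes on it, and `b` vanishes on `P ∩ N`.
  obtain ⟨N, hN⟩ := ProfiniteGrp.exist_openNormalSubgroup_sub_open_nhds_of_one
    ((hρ.inter (hc.1.isOpen_fiber 0)).inter hBo)
    ⟨⟨map_one ρ, apply_one_of_mem_Z1 hc⟩, h1B⟩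
  obtain ⟨f, hf, hfN, hfb⟩ := exists_extend_cocycle (N := N.toSubgroup)
    (fun n hn => (hN hn).1.1) (b := b) hb.2 (fun x hx => by
      have : x ∈ Subtype.val ⁻¹' B := (hN hx).2
      rwa [hB] at this)
  have hUo : IsOpen ((P ⊔ N.toSubgroup : Subgroup G) : Set G) :=
    Subgroup.isOpen_mono le_sup_right N.isOpen'
  have : Finite (G ⧸ (P ⊔ N.toSubgroup)) := Subgroup.quotient_finite_of_isOpen _ hUo
  obtain ⟨F, w, hF, hFN, hFc⟩ := exists_corestriction hπ (N := N.toSubgroup) le_sup_right hf hfN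
    hc.2 (fun g hg => by
      obtain ⟨x, hx, hfx⟩ := hfb g hg
      have h1 := hc.2 x ((x : G)⁻¹ * g)
      have h2 : c ((x : G)⁻¹ * g) = 0 := (hN hx).1.2
      rw [mul_inv_cancel_left, h2, map_zero, zero_add] at h1
      rw [hfx, hbc, h1])
  have hcop : Nat.Coprime (P ⊔ N.toSubgroup).index p :=
    ((Nat.Prime.coprime_iff_not_dvd Fact.out).2 (hP.index _ inferInstance N.isOpen')).symm
  obtain ⟨m, hm⟩ := Nat.exists_mul_mod_eq_one_of_coprime hcop (Fact.out : p.Prime).one_lt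
  have hm' : ∀ w : W, ((P ⊔ N.toSubgroup).index * m) • w = w := fun w => by
    rw [← Nat.mod_add_div ((P ⊔ N.toSubgroup).index * m) p, hm.2, add_smul, one_smul, mul_smul, hW,
      add_zero]
  -- `m` inverts the index modulo `p`. Then `m • F` lifts `c` up to the coboundary of `m • w`, which
  -- is removed by lifting `m • w` to `v`.
  obtain ⟨v, hv⟩ := hπs (m • w)
  have hcoc : ∀ g h, (m • F (g * h) - (ρ (g * h) v - v)) =
      ρ g (m • F h - (ρ h v - v)) + (m • F g - (ρ g v - v)) := fun g h => by
    simp only [hF, map_mul, Module.End.mul_apply, map_sub, map_nsmul, smul_add]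
    abel
  refine ⟨fun g => m • F g - (ρ g v - v), ⟨isLocallyConstant_of_cocycle hcoc
    (N.isOpen'.mem_nhds N.one_mem) (fun n hn => ?_), hcoc⟩, fun g => ?_⟩
  · have : ρ n = 1 := (hN hn).1.1
    simp [hFN n hn, this]
  · rw [map_sub, map_sub, hπ, hv, map_nsmul, hFc, smul_add, smul_smul, mul_comm, hm', map_nsmul,
      smul_sub]
    abel

end Transfer

/-! ### Trivial graded pieces and quotient flags -/

section Flags

variable {R G V : Type*} [CommRing R] [Group G] [AddCommGroup V] [Module R V]
  {ρ : Representation R G V}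

/-- The vector `t` lifts the element of `L_k` corresponding to `1`. Later arguments work with it
inside `V` instead of with the subquotient. -/
theorem TrivialPiece.exists_generator {F : ℕ → Subrepresentation ρ} {k : ℕ}
    (h : TrivialPiece F k) : ∃ t ∈ F k, (∀ g, ρ g t - t ∈ F (k - 1)) ∧
      (∀ v ∈ F k, ∃ a : R, v - a • t ∈ F (k - 1)) ∧ ∀ a : R, a • t ∈ F (k - 1) → a = 0 := by
  obtain ⟨e⟩ := h
  obtain ⟨⟨t, ht⟩, hte⟩ := Submodule.Quotient.mk_surjective _ (e.symm 1)
  have hE : e (Submodule.Quotient.mk ⟨t, ht⟩) = 1 := by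
    rw [hte]
    exact e.toLinearEquiv.apply_symm_apply 1
  have hinj : ∀ x, e x = 0 → x = 0 := fun x hx => e.toLinearEquiv.map_eq_zero_iff.1 hx
  refine ⟨t, ht, fun g => ?_, fun v hv => ?_, fun a ha => ?_⟩
  · have h1 : e (gradedPiece F k g (Submodule.Quotient.mk ⟨t, ht⟩) - Submodule.Quotient.mk ⟨t, ht⟩)
        = 0 := by
      rw [map_sub, sub_eq_zero]
      exact Representation.IntertwiningMap.isIntertwining _ _ e.toIntertwiningMap g _
    have h2 := hinj _ h1
    have h3 : gradedPiece F k g (Submodule.Quotient.mk ⟨t, ht⟩) - Submodule.Quotient.mk ⟨t, ht⟩ =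
      Submodule.Quotient.mk ((F k).toRepresentation g ⟨t, ht⟩ - ⟨t, ht⟩) := rfl
    rw [h3, Submodule.Quotient.mk_eq_zero] at h2
    exact h2
  · refine ⟨e (Submodule.Quotient.mk ⟨v, hv⟩), ?_⟩
    have h1 := hinj (Submodule.Quotient.mk (⟨v, hv⟩ - e (Submodule.Quotient.mk ⟨v, hv⟩) • ⟨t, ht⟩))
      (by rw [Submodule.Quotient.mk_sub, Submodule.Quotient.mk_smul, map_sub, map_smul, hE,
        smul_eq_mul, mul_one, sub_self])
    rw [Submodule.Quotient.mk_eq_zero] at h1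
    exact h1
  · have h1 : Submodule.Quotient.mk (p := (subIn (F k) (F (k - 1))).toSubmodule)
        (a • (⟨t, ht⟩ : (F k).toSubmodule)) = 0 := by
      rw [Submodule.Quotient.mk_eq_zero]
      exact ha
    have h2 := congrArg e h1
    rwa [Submodule.Quotient.mk_smul, map_smul, hE, map_zero, smul_eq_mul, mul_one] at h2

theorem TrivialPiece.sub_mem {F : ℕ → Subrepresentation ρ} {k : ℕ} (h : TrivialPiece F k) (g : G)
    {v : V} (hv : v ∈ F k) : ρ g v - v ∈ F (k - 1) := by
  obtain ⟨t, -, h1, h2, -⟩ := h.exists_generator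
  obtain ⟨a, ha⟩ := h2 v hv
  have h3 : ρ g v - v = a • (ρ g t - t) + (ρ g (v - a • t) - (v - a • t)) := by
    rw [map_sub, map_smul, smul_sub]
    abel
  rw [h3]
  exact (F (k - 1)).toSubmodule.add_mem ((F (k - 1)).toSubmodule.smul_mem a (h1 g))
    ((F (k - 1)).toSubmodule.sub_mem ((F (k - 1)).apply_mem_toSubmodule g ha) ha)

theorem pow_sub_one_eq_zero {F : ℕ → Subrepresentation ρ} {d : ℕ} (h0 : F 0 = ⊥) (hd : F d = ⊤)
    (hF : ∀ k, 1 ≤ k → k ≤ d → TrivialPiece F k) (g : G) : (ρ g - 1) ^ d = 0 := by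
  have key : ∀ k ≤ d, ∀ v ∈ F k, ((ρ g - 1) ^ k) v = 0 := by
    intro k
    induction k with
    | zero =>
      intro _ v hv
      rw [h0] at hv
      simpa using! hv
    | succ k ih =>
      intro hk v hv
      rw [pow_succ, Module.End.mul_apply]
      exact ih (by omega) _ ((hF (k + 1) (by omega) hk).sub_mem g hv)
  ext v
  refine key d le_rfl v ?_
  rw [hd]
  exact Submodule.mem_top (R := R)

theorem imageIn_mono (S : Subrepresentation ρ) {T T' : Subrepresentation ρ} (h : T ≤ T') :
    imageIn S T ≤ imageIn S T' :=
  Submodule.map_mono (f := S.toSubmodule.mkQ) (show T.toSubmodule ≤ T'.toSubmodule from h)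

theorem imageIn_eq_bot {S T : Subrepresentation ρ} (h : T.toSubmodule ≤ S.toSubmodule) :
    imageIn S T = ⊥ :=
  Subrepresentation.ext (by
    change T.toSubmodule.map S.toSubmodule.mkQ = ⊥
    rw [eq_bot_iff, Submodule.map_le_iff_le_comap]
    intro v hv
    exact (Submodule.Quotient.mk_eq_zero _).2 (h hv))

theorem imageIn_eq_top {S T : Subrepresentation ρ} (h : S.toSubmodule ⊔ T.toSubmodule = ⊤) :
    imageIn S T = ⊤ :=
  Subrepresentation.ext (by
    change T.toSubmodule.map S.toSubmodule.mkQ = ⊤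
    rw [Submodule.map_mkQ_eq_top, h])

end Flags

/-! ### Unipotent actions factor through `p`-groups -/

section Unipotent

/-- If `p` is nilpotent, unipotent elements have `p`-power order. -/
theorem exists_one_add_pow_eq_one {A : Type*} [Ring A] {p r : ℕ} (hp : p.Prime)
    (hA : (p : A) ^ r = 0) {n : A} (hn : IsNilpotent n) : ∃ m, (1 + n) ^ p ^ m = 1 := by
  obtain ⟨a, ha⟩ := hn
  -- The exponent `p ^ a` kills the power of `n`, since `a < p ^ a`, and leaves a multiple of `p`.
  -- Every further `p`-th power gains one factor `p`.
  have key : ∀ i : ℕ, ∃ s : A, (1 + n) ^ p ^ (a + i) = 1 + (p : A) ^ (i + 1) * s := by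
    intro i
    induction i with
    | zero =>
      obtain ⟨s, hs⟩ := (Commute.one_left n).exists_add_pow_prime_pow_eq hp a
      refine ⟨n * s, ?_⟩
      rw [add_zero, hs, pow_eq_zero_of_le (Nat.lt_pow_self hp.one_lt).le ha]
      simp [mul_assoc]
    | succ i ih =>
      obtain ⟨s, hs⟩ := ih
      obtain ⟨t, ht⟩ := (Commute.one_left ((p : A) ^ (i + 1) * s)).exists_add_pow_prime_eq hp
      have h1 : ((p : A) ^ (i + 1) * s) ^ p =
          (p : A) ^ (i + 1 + 1) * ((p : A) ^ ((i + 1) * p - (i + 2)) * s ^ p) := by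
        rw [((Nat.cast_commute p s).pow_left _).mul_pow, ← pow_mul, ← mul_assoc, ← pow_add]
        congr 2
        have : (i + 1) * 2 ≤ (i + 1) * p := Nat.mul_le_mul_left _ hp.two_le
        omega
      refine ⟨(p : A) ^ ((i + 1) * p - (i + 2)) * s ^ p + s * t, ?_⟩
      rw [← add_assoc, pow_succ p, pow_mul, hs, ht, h1, one_pow, mul_one, mul_add, pow_succ' _ (i + 1)]
      simp only [mul_assoc, add_assoc]
  obtain ⟨s, hs⟩ := key r
  refine ⟨a + r, ?_⟩
  rw [hs, pow_succ, hA, zero_mul, zero_mul, add_zero]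

/-- A pro-`p`-Sylow subgroup has the same image as the whole group in a representation whose
image is a `p`-group. -/
theorem IsProPSylow.exists_apply_eq {k G V : Type*} [CommRing k] [Group G] [TopologicalSpace G]
    [IsTopologicalGroup G] [CompactSpace G] [AddCommGroup V] [Module k V] {p : ℕ} [Fact p.Prime]
    {P : Subgroup G} (hP : IsProPSylow p P) {ρ : Representation k G V}
    (hρ : IsOpen {g : G | ρ g = 1}) (hpow : ∀ g, ∃ m, ρ g ^ p ^ m = 1) (g : G) :
    ∃ x : P, ρ x = ρ g := by
  have hker : (ρ.toHomUnits.ker : Set G) = {g : G | ρ g = 1} := by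
    ext g
    simp [MonoidHom.mem_ker]
  set N := ρ.toHomUnits.ker
  have hmem : ∀ g, g ∈ N ↔ ρ g = 1 := fun g => by rw [← SetLike.mem_coe, hker]; rfl
  have hNo : IsOpen (N : Set G) := hker ▸ hρ
  have hfin : Finite (G ⧸ N) := Subgroup.quotient_finite_of_isOpen _ hNo
  have hpg : IsPGroup p (G ⧸ N) := by
    intro x
    obtain ⟨g, rfl⟩ := QuotientGroup.mk_surjective x
    obtain ⟨m, hm⟩ := hpow g
    refine ⟨m, ?_⟩
    rw [← QuotientGroup.mk_pow, QuotientGroup.eq_one_iff, hmem, map_pow, hm]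
  obtain ⟨n, hn⟩ := IsPGroup.iff_card.1 hpg
  -- The index of `P N` is a power of `p`, and prime to `p` by the Sylow property, so `P N` is
  -- everything.
  have hdvd : (P ⊔ N).index ∣ p ^ n := by
    rw [← hn, ← Subgroup.index_eq_card]
    exact Subgroup.index_dvd_of_le le_sup_right
  obtain ⟨j, -, hj⟩ := (Nat.dvd_prime_pow Fact.out).1 hdvd
  have hj0 : j = 0 := by
    by_contra hj0
    exact hP.index N inferInstance hNo (hj ▸ dvd_pow_self p hj0)
  rw [hj0, pow_zero, Subgroup.index_eq_one] at hj
  have hg : g ∈ ((P ⊔ N : Subgroup G) : Set G) := by rw [hj]; trivial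
  rw [Subgroup.mul_normal] at hg
  obtain ⟨x, hx, y, hy, rfl⟩ := hg
  exact ⟨⟨x, hx⟩, by rw [map_mul, (hmem y).1 hy, mul_one]⟩

end Unipotent

/-! ### Invariant functionals on Kummer flags -/

section Kummer

variable {p r : ℕ} [Fact p.Prime] {G : Type*} [Group G]

/-- Invariant functionals on the reduction of a Kummer flag lift. -/
theorem IsKummer.exists_lift_functional (hr : r ≠ 0) (d : ℕ) :
    ∀ {V : Type v} [AddCommGroup V] [Module (ZMod (p ^ r)) V]
      {ρ : Representation (ZMod (p ^ r)) G V} {F : ℕ → Subrepresentation ρ},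
      F 0 = ⊥ → F d = ⊤ → (∀ i < d, F i ≤ F (i + 1)) → IsKummer p d ρ F →
      ∀ f : V →ₛₗ[redP p hr] ZMod p, (∀ g v, f (ρ g v) = f v) →
        ∃ f' : V →ₗ[ZMod (p ^ r)] ZMod (p ^ r), (∀ g v, f' (ρ g v) = f' v) ∧
          ∀ v, redP p hr (f' v) = f v := by
  induction d with
  | zero =>
    intro V _ _ ρ F h0 hd _ _ f _
    have hV : ∀ v : V, v = 0 := fun v => by
      have : v ∈ F 0 := by rw [hd]; exact Submodule.mem_top (R := ZMod (p ^ r))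
      rw [h0] at this
      simpa using! this
    exact ⟨0, fun g v => by simp, fun v => by simp [hV v]⟩
  | succ d ih =>
    intro V _ _ ρ F h0 hd hmono hK f hf
    obtain ⟨h1, h2, -, h4, h5⟩ := hK
    have hbot : ∀ v ∈ F 0, v = 0 := fun v hv => by
      rw [h0] at hv
      simpa using! hv
    obtain ⟨e, he, heg, hespan, hefree⟩ := (h2 1 le_rfl (by omega)).exists_generator
    rw [Nat.sub_self] at heg hespan hefree
    have hρe : ∀ g, ρ g e = e := fun g => sub_eq_zero.1 (hbot _ (heg g))
    have hespan' : ∀ v ∈ F 1, ∃ a : ZMod (p ^ r), v = a • e := fun v hv => by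
      obtain ⟨a, ha⟩ := hespan v hv
      exact ⟨a, sub_eq_zero.1 (hbot _ ha)⟩
    have descend : ∀ T : Subrepresentation ρ, (∀ v ∈ T, f v = 0) →
        ∀ F' : ℕ → Subrepresentation (quot T), F' 0 = ⊥ → F' d = ⊤ →
        (∀ i < d, F' i ≤ F' (i + 1)) → IsKummer p d (quot T) F' →
        ∃ f' : V →ₗ[ZMod (p ^ r)] ZMod (p ^ r), (∀ g v, f' (ρ g v) = f' v) ∧
          ∀ v, redP p hr (f' v) = f v := by
      intro T hT F' h0' hd' hmono' hK'
      obtain ⟨f', hf', hred⟩ := ih h0' hd' hmono' hK' (T.toSubmodule.liftQ f hT) (fun g v => by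
        obtain ⟨v, rfl⟩ := Submodule.Quotient.mk_surjective _ v
        exact hf g v)
      exact ⟨f' ∘ₗ T.toSubmodule.mkQ, fun g v => hf' g (Submodule.Quotient.mk v),
        fun v => hred (Submodule.Quotient.mk v)⟩
    -- If `f` kills the generator `e` of `F 1`, it factors through `V / F 1`, whose flag is Kummer.
    by_cases hfe : f e = 0
    · refine descend (F 1) (fun v hv => ?_) _ (imageIn_eq_bot le_rfl) ?_ (fun i hi => ?_) h4
      · obtain ⟨a, rfl⟩ := hespan' v hv
        rw [map_smulₛₗ, hfe, smul_zero]
      · apply imageIn_eq_top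
        rw [hd]
        exact sup_top_eq _
      · exact imageIn_mono _ (hmono _ (by omega))
    rcases Nat.eq_zero_or_pos d with rfl | hdpos
    · have hbij : Function.Bijective (LinearMap.toSpanSingleton (ZMod (p ^ r)) V e) := by
        refine ⟨(injective_iff_map_eq_zero _).2 fun a ha => hefree a ?_, fun v => ?_⟩
        · rw [LinearMap.toSpanSingleton_apply] at ha
          rw [ha]
          exact (F 0).toSubmodule.zero_mem
        · obtain ⟨a, ha⟩ := hespan' v (by rw [hd]; exact Submodule.mem_top (R := ZMod (p ^ r)))
          exact ⟨a, ha.symm⟩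
      let E := LinearEquiv.ofBijective _ hbij
      obtain ⟨u, hu⟩ := redP_surjective hr (f e)
      have hE : ∀ a, E a = a • e := fun a => rfl
      refine ⟨u • E.symm.toLinearMap, fun g v => ?_, fun v => ?_⟩
      · obtain ⟨a, rfl⟩ := E.surjective v
        rw [hE, map_smul, hρe]
      · obtain ⟨a, rfl⟩ := E.surjective v
        rw [LinearMap.smul_apply, LinearEquiv.coe_coe, LinearEquiv.symm_apply_apply, hE,
          LinearMap.map_smulₛₗ f, smul_eq_mul, map_mul, hu, smul_eq_mul, mul_comm]
    have h12 : F 1 ≤ F 2 := hmono 1 (by omega)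
    -- As `f e ≠ 0`, the kernel of `f` in `F 2` becomes modulo `p` a stable complement of `F 1`.
    have hsplit0 : splitIndex (reduce p F) 2 = 0 := by
      apply Nat.sInf_eq_zero.2
      left
      let K : Subrepresentation ρ :=
        { toSubmodule := (F 2).toSubmodule ⊓ LinearMap.ker f
          apply_mem_toSubmodule := fun g v hv =>
            ⟨(F 2).apply_mem_toSubmodule g hv.1, (hf g v).trans hv.2⟩ }
      refine ⟨Nat.zero_le _, imageIn (pMul p ρ) K, ?_, ?_⟩
      · apply Subrepresentation.ext
        apply le_antisymm
        · rintro _ ⟨⟨t, ht, rfl⟩, ⟨a, ha, hat⟩⟩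
          obtain ⟨v, hv⟩ := (Submodule.Quotient.eq _).1 hat
          obtain ⟨c, rfl⟩ := hespan' a ha
          have h3 := congrArg f hv
          rw [map_sub, show f t = 0 from ht.2, LinearMap.smul_apply, map_smulₛₗ, map_smulₛₗ,
            redP_natCast, ZMod.natCast_self, zero_smul, sub_zero, smul_eq_mul] at h3
          have h6 : redP p hr c = 0 := (mul_eq_zero.1 h3.symm).resolve_right hfe
          obtain ⟨c', rfl⟩ := (redP_eq_zero_iff hr c).1 h6
          rw [← hat]
          refine ⟨0, (F 0).toSubmodule.zero_mem, ?_⟩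
          rw [map_zero, eq_comm]
          refine (Submodule.Quotient.mk_eq_zero _).2 ⟨c' • e, ?_⟩
          rw [LinearMap.smul_apply, LinearMap.id_apply, smul_smul]
        · rintro _ ⟨v, hv, rfl⟩
          rw [hbot v hv, map_zero]
          exact Submodule.zero_mem _
      · apply Subrepresentation.ext
        change K.toSubmodule.map (pMul p ρ).toSubmodule.mkQ ⊔
          (F 1).toSubmodule.map (pMul p ρ).toSubmodule.mkQ =
          (F 2).toSubmodule.map (pMul p ρ).toSubmodule.mkQ
        rw [← Submodule.map_sup]
        congr 1
        refine le_antisymm (sup_le (fun v hv => hv.1) h12) ?_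
        intro v hv
        obtain ⟨y, hy⟩ := redP_surjective hr (f v / f e)
        rw [← sub_add_cancel v (y • e)]
        have hye : y • e ∈ (F 1).toSubmodule := (F 1).toSubmodule.smul_mem _ he
        refine Submodule.add_mem_sup ⟨(F 2).toSubmodule.sub_mem hv (h12 hye), ?_⟩ hye
        change f (v - y • e) = 0
        rw [map_sub, map_smulₛₗ, hy, smul_eq_mul, div_mul_cancel₀ _ hfe, sub_self]
    have hsplit : splitIndex F 2 = 0 := (h1 2 (by omega) (by omega)).trans hsplit0
    have hS : SplitsAt F 0 2 := by
      have hne : {i | i ≤ 2 - 1 ∧ SplitsAt F i 2}.Nonempty :=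
        ⟨1, le_rfl, F 2, inf_eq_right.2 h12, sup_eq_left.2 h12⟩
      have := Nat.sInf_mem hne
      rw [show sInf {i | i ≤ 2 - 1 ∧ SplitsAt F i 2} = 0 from hsplit] at this
      exact this.2
    obtain ⟨T, hT1, hT2⟩ := hS
    obtain ⟨t₀, ht₀, ht₀g, ht₀span, ht₀free⟩ := (h2 2 (by omega) (by omega)).exists_generator
    obtain ⟨t, ht, a, ha, rfl⟩ : ∃ t ∈ T.toSubmodule, ∃ a ∈ (F 1).toSubmodule, t + a = t₀ := by
      have : t₀ ∈ T.toSubmodule ⊔ (F 1).toSubmodule := by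
        have h6 := congrArg Subrepresentation.toSubmodule hT2
        change T.toSubmodule ⊔ (F 1).toSubmodule = _ at h6
        rw [h6]
        exact ht₀
      exact Submodule.mem_sup.1 this
    -- The difference `ρ g t - t` lies in `T` by stability and in `F 1` by triviality of `L_2` and
    -- stability of `F 1`, and these meet in `0`.
    have hρt : ∀ g, ρ g t = t := fun g => by
      rw [← sub_eq_zero]
      apply hbot
      rw [← hT1]
      refine ⟨T.toSubmodule.sub_mem (T.apply_mem_toSubmodule g ht) ht, ?_⟩
      have h6 : ρ g t - t = (ρ g (t + a) - (t + a)) - (ρ g a - a) := by rw [map_add]; abel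
      change ρ g t - t ∈ (F 1).toSubmodule
      rw [h6]
      exact (F 1).toSubmodule.sub_mem (ht₀g g)
        ((F 1).toSubmodule.sub_mem ((F 1).apply_mem_toSubmodule g ha) ha)
    -- Subtracting `y • e` puts the generator of the complement into the kernel of `f`. It remains
    -- fixed because `e` is, and the Kummer condition covers every section, hence also this one.
    obtain ⟨y, hy⟩ := redP_surjective hr (f t / f e)
    have hye : y • e ∈ (F 1).toSubmodule := (F 1).toSubmodule.smul_mem _ he
    have ht2 : t ∈ (F 2).toSubmodule := by
      have := (F 2).toSubmodule.sub_mem ht₀ (h12 ha)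
      rwa [add_sub_cancel_right] at this
    have hfree : ∀ c : ZMod (p ^ r), c • (t - y • e) ∈ F 1 → c = 0 := fun c hc => by
      apply ht₀free
      have h6 : c • (t + a) = c • (t - y • e) + c • (y • e + a) := by
        simp only [smul_sub, smul_add]
        abel
      rw [h6]
      exact (F 1).toSubmodule.add_mem hc
        ((F 1).toSubmodule.smul_mem _ ((F 1).toSubmodule.add_mem hye ha))
    have hft : f (t - y • e) = 0 := by
      rw [map_sub, map_smulₛₗ, hy, smul_eq_mul, div_mul_cancel₀ _ hfe, sub_self]
    let T' : Subrepresentation ρ :=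
      { toSubmodule := Submodule.span (ZMod (p ^ r)) {t - y • e}
        apply_mem_toSubmodule := fun g v hv => by
          obtain ⟨c, rfl⟩ := Submodule.mem_span_singleton.1 hv
          rw [map_smul, map_sub, map_smul, hρe, hρt]
          exact hv }
    have hT'1 : T' ⊓ F 1 = ⊥ := by
      apply Subrepresentation.ext
      change T'.toSubmodule ⊓ (F 1).toSubmodule = ⊥
      rw [eq_bot_iff]
      rintro v ⟨hv, hv1⟩
      obtain ⟨c, rfl⟩ := Submodule.mem_span_singleton.1 hv
      rw [hfree c hv1, zero_smul]
      exact Submodule.zero_mem _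
    have hT'2 : T'.toSubmodule ⊔ (F 1).toSubmodule = (F 2).toSubmodule := by
      apply le_antisymm
      · refine sup_le ?_ h12
        change Submodule.span (ZMod (p ^ r)) {t - y • e} ≤ _
        rw [Submodule.span_le, Set.singleton_subset_iff]
        exact (F 2).toSubmodule.sub_mem ht2 (h12 hye)
      · intro v hv
        obtain ⟨c, hc⟩ := ht₀span v hv
        have h6 : v = c • (t - y • e) + ((v - c • (t + a)) + c • (y • e + a)) := by
          simp only [smul_sub, smul_add]
          abel
        rw [h6]
        exact Submodule.add_mem_sup
          (Submodule.smul_mem _ _ (Submodule.mem_span_singleton_self _))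
          ((F 1).toSubmodule.add_mem hc
            ((F 1).toSubmodule.smul_mem _ ((F 1).toSubmodule.add_mem hye ha)))
    refine descend T' (fun v hv => ?_) _ ?_ ?_ (fun i hi => ?_)
      (h5 2 le_rfl (by omega) hsplit T' hT'1 (Subrepresentation.ext hT'2))
    · obtain ⟨c, rfl⟩ := Submodule.mem_span_singleton.1 hv
      rw [map_smulₛₗ, hft, smul_zero]
    · apply imageIn_eq_bot
      rw [if_pos (by omega), h0]
      exact bot_le
    · apply imageIn_eq_top
      -- In rank two the repeated step is the last one, so the induced flag ends with the image of
      -- `F 1`.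
      split_ifs with h
      · obtain rfl : d = 1 := by omega
        rw [hT'2, hd]
        rfl
      · rw [hd]
        exact sup_top_eq _
    · apply imageIn_mono
      split_ifs with h6 h7 h7
      · exact hmono _ (by omega)
      · obtain rfl : i = 1 := by omega
        exact h12.trans (hmono 2 (by omega))
      · omega
      · exact hmono _ (by omega)

end Kummer

/-! ### The lifting criterion in terms of invariant functionals -/

section Functionals

/-- The transpose sends the coordinate functionals to the `f i`, so independence says that the
transpose is injective. -/
theorem surjective_pi_of_linearIndependent {K W ι : Type*} [Field K] [AddCommGroup W] [Module K W]
    [Finite ι] {f : ι → Module.Dual K W} (hf : LinearIndependent K f) :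
    Function.Surjective (LinearMap.pi f) := by
  classical
  have := Fintype.ofFinite ι
  rw [← LinearMap.dualMap_injective_iff, injective_iff_map_eq_zero]
  intro φ hφ
  have h1 : ∑ i, φ (Pi.single i 1) • f i = 0 := by
    ext w
    have h2 := LinearMap.congr_fun hφ w
    rw [LinearMap.dualMap_apply, LinearMap.pi_apply_eq_sum_univ φ] at h2
    rw [LinearMap.sum_apply, ← h2]
    refine Finset.sum_congr rfl fun i _ => ?_
    rw [LinearMap.smul_apply, smul_eq_mul, LinearMap.pi_apply, smul_eq_mul, mul_comm]
    congr 2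
    ext j
    simp [Pi.single_apply, eq_comm]
  have h3 := Fintype.linearIndependent_iff.1 hf _ h1
  refine LinearMap.pi_ext' fun i => LinearMap.ext_ring ?_
  simpa using h3 i

theorem Submodule.exists_fin_basis {K W : Type*} [Field K] [AddCommGroup W] [Module K W]
    [Module.Finite K W] (A : Submodule K W) :
    ∃ (n : ℕ) (f : Fin n → W), LinearIndependent K f ∧ (∀ i, f i ∈ A) ∧
      ∀ x ∈ A, ∃ a : Fin n → K, x = ∑ i, a i • f i := by
  let B := Module.finBasis K A
  refine ⟨_, fun i => A.subtype (B i), B.linearIndependent.map' _ (Submodule.ker_subtype _),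
    fun i => (B i).2, fun x hx => ⟨fun i => B.repr ⟨x, hx⟩ i, ?_⟩⟩
  have := congrArg A.subtype (B.sum_repr ⟨x, hx⟩)
  rw [map_sum] at this
  simp only [map_smul] at this
  exact this.symm

/-- The space of invariant functionals on a representation. -/
def invariantFunctionals {K W G : Type*} [Field K] [AddCommGroup W] [Module K W] [Group G]
    (σ : Representation K G W) : Submodule K (Module.Dual K W) :=
  ⨅ g, LinearMap.ker ((σ g).dualMap - LinearMap.id)

theorem mem_invariantFunctionals {K W G : Type*} [Field K] [AddCommGroup W] [Module K W] [Group G]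
    {σ : Representation K G W} {f : Module.Dual K W} :
    f ∈ invariantFunctionals σ ↔ ∀ g w, f (σ g w) = f w := by
  rw [invariantFunctionals, Submodule.mem_iInf]
  refine forall_congr' fun g => ?_
  rw [LinearMap.mem_ker, LinearMap.sub_apply, sub_eq_zero, LinearMap.ext_iff]
  rfl

theorem exists_basis_invariant_functionals {K W G : Type*} [Field K] [AddCommGroup W] [Module K W]
    [Module.Finite K W] [Group G] (σ : Representation K G W) :
    ∃ (n : ℕ) (f : Fin n → Module.Dual K W), LinearIndependent K f ∧
      (∀ i g w, f i (σ g w) = f i w) ∧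
      ∀ f' : Module.Dual K W, (∀ g w, f' (σ g w) = f' w) →
        ∃ a : Fin n → K, f' = ∑ i, a i • f i := by
  obtain ⟨n, f, hf, hfA, hfs⟩ := Submodule.exists_fin_basis (invariantFunctionals σ)
  exact ⟨n, f, hf, fun i => mem_invariantFunctionals.1 (hfA i),
    fun f' hf' => hfs f' (mem_invariantFunctionals.2 hf')⟩

variable {p r : ℕ} [Fact p.Prime]

/-- Nakayama by successive approximation: every vector is hit up to a multiple of `p ^ m`, and `p ^
r = 0`. -/
theorem surjective_of_surjective_redP (hr : r ≠ 0) {V : Type*} [AddCommGroup V]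
    [Module (ZMod (p ^ r)) V] {ι : Type*} {φ : V →ₗ[ZMod (p ^ r)] ι → ZMod (p ^ r)}
    (h : ∀ y : ι → ZMod p, ∃ v, ∀ i, redP p hr (φ v i) = y i) : Function.Surjective φ := by
  have key : ∀ m : ℕ, ∀ y : ι → ZMod (p ^ r), ∃ v z, y = φ v + (p : ZMod (p ^ r)) ^ m • z := by
    intro m
    induction m with
    | zero => exact fun y => ⟨0, y, by simp⟩
    | succ m ih =>
      intro y
      obtain ⟨v, z, rfl⟩ := ih y
      obtain ⟨v', hv'⟩ := h (fun i => redP p hr (z i))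
      have h1 : ∀ i, ∃ t, z i - φ v' i = p * t := fun i => by
        rw [← redP_eq_zero_iff hr, map_sub, hv', sub_self]
      choose t ht using h1
      have h2 : z = φ v' + (p : ZMod (p ^ r)) • t := by
        ext i
        rw [Pi.add_apply, Pi.smul_apply, smul_eq_mul, ← ht]
        ring
      refine ⟨v + (p : ZMod (p ^ r)) ^ m • v', t, ?_⟩
      rw [h2, map_add, map_smul, smul_add, smul_smul, ← pow_succ, add_assoc]
  intro y
  obtain ⟨v, z, rfl⟩ := key r y
  exact ⟨v, by rw [natCast_pow_eq_zero, zero_smul, add_zero]⟩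

variable {V : Type*} [AddCommGroup V] [Module (ZMod (p ^ r)) V]
  {W : Type v} [AddCommGroup W] [Module (ZMod p) W]

/-- Additivity is enough, because every scalar is the class of a natural number. -/
theorem map_smul_redP (π : V →+ W) (hr : r ≠ 0) (a : ZMod (p ^ r))
    (v : V) : π (a • v) = redP p hr a • π v := by
  rw [← ZMod.natCast_zmod_val a, redP_natCast, Nat.cast_smul_eq_nsmul, Nat.cast_smul_eq_nsmul,
    map_nsmul]

variable {G : Type*} [Group G] [TopologicalSpace G] [IsTopologicalGroup G] [CompactSpace G] [T2Space G]
  [TotallyDisconnectedSpace G]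

/-- Criterion for the surjectivity of the reduction map on `H¹`: invariant functionals on the
reduction lift to invariant functionals. -/
theorem IsReduction.exists_lift_Z1_of_functionals (hr : r ≠ 0) {P : Subgroup G}
    (hP : IsProPSylow p P) (hD : IsDemushkin p P) (hH90 : LiftsCharacters p r P hr)
    [Module.Free (ZMod (p ^ r)) V] [Module.Finite (ZMod (p ^ r)) V] [Module.Finite (ZMod p) W]
    {ρ : Representation (ZMod (p ^ r)) G V} (hρ : IsOpen {g : G | ρ g = 1})
    {σ : Representation (ZMod p) G W} {π : V →+ W} (hπ : IsReduction ρ σ π)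
    (hσ : ∀ g, ∃ x : P, σ x = σ g)
    (hfun : ∀ f : Module.Dual (ZMod p) W, (∀ g w, f (σ g w) = f w) →
      ∃ f' : V →ₗ[ZMod (p ^ r)] ZMod (p ^ r), (∀ g v, f' (ρ g v) = f' v) ∧
        ∀ v, redP p hr (f' v) = f (π v))
    {c : G → W} (hc : c ∈ Z1 σ) : ∃ b ∈ Z1 ρ, ∀ g, π (b g) = c g := by
  refine hP.exists_lift_Z1 hπ.surjective hπ.map_apply hρ
    (fun w => by rw [← Nat.cast_smul_eq_nsmul (ZMod p)]; simp) (fun c hc => ?_) hc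
  obtain ⟨n, f, hfli, hfinv, hfspan⟩ := exists_basis_invariant_functionals σ
  choose f' hf'inv hf'red using fun i => hfun (f i) (hfinv i)
  -- The lifts of a basis of invariant functionals form a surjection onto a free module, since
  -- modulo `p` the basis is linearly independent.
  have hsurj : Function.Surjective (LinearMap.pi f') := by
    refine surjective_of_surjective_redP hr fun y => ?_
    obtain ⟨w, hw⟩ := surjective_pi_of_linearIndependent hfli y
    obtain ⟨v, rfl⟩ := hπ.surjective w
    exact ⟨v, fun i => (hf'red i v).trans (congrFun hw i)⟩
  have hπ' : IsReduction (G := P) (ρ.comp P.subtype) (σ.comp P.subtype) π :=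
    ⟨hπ.surjective, fun g => hπ.map_apply g, hπ.eq_zero_iff⟩
  refine hπ'.exists_lift_Z1 hr hH90 hD hP.isProP
    ((isLocallyConstant_of_isOpen_ker hρ).comp_continuous continuous_subtype_val)
    hsurj (fun g v => funext fun i => hf'inv i g v) (fun f₀ hf₀ v hv => ?_) hc
  -- Duality over `P` involves `P`-invariant functionals. They are `Γ`-invariant because `P` and `Γ`
  -- have the same image.
  obtain ⟨a, rfl⟩ := hfspan f₀ (fun g w => by
    obtain ⟨x, hx⟩ := hσ g
    rw [← hx]
    exact hf₀ x w)
  rw [LinearMap.sum_apply]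
  refine Finset.sum_eq_zero fun i _ => ?_
  have h1 : f' i v = 0 := congrFun hv i
  rw [LinearMap.smul_apply, ← hf'red, h1, map_zero, smul_zero]

end Functionals

/-! ### Flags from unitriangular coordinates -/

section Unitriangular

variable {R G V : Type*} [CommRing R] [Group G] [AddCommGroup V] [Module R V]

/-- In the coordinates `b`, the action is by upper unitriangular matrices. -/
def IsUnitriangular {d : ℕ} (ρ : Representation R G V) (b : V ≃ₗ[R] (Fin d → R)) : Prop :=
  ∀ (k : ℕ) (v : V), (∀ j : Fin d, k + 1 ≤ j → b v j = 0) →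
    ∀ (g : G) (j : Fin d), k ≤ j → b (ρ g v) j = b v j

variable {d : ℕ} {ρ : Representation R G V} {b : V ≃ₗ[R] (Fin d → R)}

/-- The flag attached to unitriangular coordinates. -/
def coordFlag (hb : IsUnitriangular ρ b) (k : ℕ) : Subrepresentation ρ where
  toSubmodule :=
    { carrier := {v | ∀ j : Fin d, k ≤ j → b v j = 0}
      zero_mem' := fun j _ => by simp
      add_mem' := fun {x y} hx hy j hj => by
        rw [map_add, Pi.add_apply, hx j hj, hy j hj, add_zero]
      smul_mem' := fun t x hx j hj => by rw [map_smul, Pi.smul_apply, hx j hj, smul_zero] }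
  apply_mem_toSubmodule g v hv j hj :=
    (hb k v (fun j hj => hv j (by omega)) g j hj).trans (hv j hj)

/-- Coordinates on the steps of the flag. -/
def coordFlagEquiv (hb : IsUnitriangular ρ b) {k : ℕ} (hk : k ≤ d) :
    (coordFlag hb k).toSubmodule ≃ₗ[R] (Fin k → R) where
  toFun v i := b v.1 (Fin.castLE hk i)
  map_add' x y := by ext i; simp
  map_smul' t x := by ext i; simp
  invFun y := ⟨b.symm fun j => if h : (j : ℕ) < k then y ⟨j, h⟩ else 0, fun j hj => by
    rw [LinearEquiv.apply_symm_apply, dif_neg (by omega)]⟩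
  left_inv v := by
    apply Subtype.ext
    apply b.injective
    ext j
    change b (b.symm fun j : Fin d => if h : (j : ℕ) < k then b v.1 (Fin.castLE hk ⟨j, h⟩) else 0) j
      = _
    rw [LinearEquiv.apply_symm_apply]
    split_ifs with h
    · rfl
    · exact (v.2 j (by omega)).symm
  right_inv y := by
    ext i
    change b (b.symm fun j : Fin d => if h : (j : ℕ) < k then y ⟨j, h⟩ else 0) (Fin.castLE hk i) = _
    rw [LinearEquiv.apply_symm_apply, dif_pos (by simp)]
    rfl

theorem trivialPiece_coordFlag (hb : IsUnitriangular ρ b) {k : ℕ} (hk1 : 1 ≤ k) (hk : k ≤ d) :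
    TrivialPiece (coordFlag hb) k := by
  -- Coordinates are numbered from `0`, so `L_k` is read off by the coordinate `k - 1`.
  let j₀ : Fin d := ⟨k - 1, by omega⟩
  let l : (coordFlag hb k).toSubmodule →ₗ[R] R :=
    LinearMap.proj j₀ ∘ₗ b.toLinearMap ∘ₗ (coordFlag hb k).toSubmodule.subtype
  have hl : ∀ v, l v = b v.1 j₀ := fun v => rfl
  have hsurj : Function.Surjective l := fun a => by
    refine ⟨⟨b.symm (Pi.single j₀ a), fun j hj => ?_⟩, ?_⟩
    · have h1 : j ≠ j₀ := by
        rintro rfl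
        have : k ≤ k - 1 := hj
        omega
      rw [LinearEquiv.apply_symm_apply, Pi.single_eq_of_ne h1]
    · rw [hl, LinearEquiv.apply_symm_apply, Pi.single_eq_same]
  have hker : (subIn (coordFlag hb k) (coordFlag hb (k - 1))).toSubmodule = LinearMap.ker l := by
    ext v
    refine ⟨fun h => h j₀ le_rfl, fun h j hj => ?_⟩
    rcases Nat.eq_or_lt_of_le hj with hj' | hj'
    · have : j = j₀ := Fin.ext hj'.symm
      rw [this]
      exact h
    · exact v.2 j (by omega)
  refine ⟨Representation.Equiv.mk ((Submodule.quotEquivOfEq _ _ hker).trans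
    (l.quotKerEquivOfSurjective hsurj)) fun g => ?_⟩
  refine LinearMap.ext fun x => ?_
  obtain ⟨v, rfl⟩ := Submodule.Quotient.mk_surjective _ x
  refine hb (k - 1) v.1 (fun j hj => v.2 j (by omega)) g j₀ le_rfl

theorem IsUnitriangular.isCompleteFlag [Nontrivial R] (hb : IsUnitriangular ρ b) :
    IsCompleteFlag ρ d (coordFlag hb) where
  zero := Subrepresentation.ext (by
    change _ = (⊥ : Submodule R V)
    rw [eq_bot_iff]
    intro v hv
    exact b.map_eq_zero_iff.1 (funext fun j => hv j (Nat.zero_le _)))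
  top := Subrepresentation.ext (by
    change _ = (⊤ : Submodule R V)
    rw [eq_top_iff]
    intro v _ j hj
    omega)
  mono i _ v hv j hj := hv j (by omega)
  free i hi := Module.Free.of_equiv (coordFlagEquiv hb hi).symm
  rank i hi := by rw [(coordFlagEquiv hb hi).finrank_eq, Module.finrank_fin_fun]

theorem IsUnitriangular.isUnipotent [Nontrivial R] (hb : IsUnitriangular ρ b) : IsUnipotent ρ :=
  ⟨d, coordFlag hb, hb.isCompleteFlag, fun _ h1 h2 => trivialPiece_coordFlag hb h1 h2⟩

theorem exists_pow_eq_one {p r : ℕ} (hp : p.Prime) (hR : (p : R) ^ r = 0)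
    {F : ℕ → Subrepresentation ρ} (h0 : F 0 = ⊥) (hd : F d = ⊤)
    (hF : ∀ k, 1 ≤ k → k ≤ d → TrivialPiece F k) (g : G) : ∃ m, ρ g ^ p ^ m = 1 := by
  have h1 : (p : Module.End R V) ^ r = 0 := by
    ext v
    rw [← Nat.cast_pow, Module.End.natCast_apply, ← Nat.cast_smul_eq_nsmul R, Nat.cast_pow, hR,
      zero_smul, LinearMap.zero_apply]
  obtain ⟨m, hm⟩ := exists_one_add_pow_eq_one hp h1 ⟨d, pow_sub_one_eq_zero h0 hd hF g⟩
  exact ⟨m, by rwa [add_sub_cancel] at hm⟩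

end Unitriangular

/-! ### Extensions of a trivial representation by cocycles -/

section Extension

variable {R G K : Type*} [CommRing R] [Group G] [AddCommGroup K] [Module R K] {n : ℕ}

/-- The linear map `(k, t) ↦ (A k + ∑ tᵢ βᵢ, t)`. -/
def extMap (A : K →ₗ[R] K) (β : Fin n → K) : K × (Fin n → R) →ₗ[R] K × (Fin n → R) :=
  (A ∘ₗ LinearMap.fst R K _ + Fintype.linearCombination R β ∘ₗ LinearMap.snd R K _).prod
    (LinearMap.snd R K _)

theorem extMap_apply (A : K →ₗ[R] K) (β : Fin n → K) (x : K × (Fin n → R)) :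
    extMap A β x = (A x.1 + ∑ i, x.2 i • β i, x.2) := rfl

/-- The extension of the trivial representation `Rⁿ` by `K` with classes `β`. -/
def extRep (ρ : Representation R G K) (β : Fin n → G → K)
    (hβ : ∀ i g h, β i (g * h) = ρ g (β i h) + β i g) : Representation R G (K × (Fin n → R)) where
  toFun g := extMap (ρ g) (fun i => β i g)
  map_one' := by
    have h1 : ∀ i, β i 1 = 0 := fun i => by
      have := hβ i 1 1
      rw [mul_one, map_one, Module.End.one_apply] at this
      simpa using this
    refine LinearMap.ext fun x => ?_
    rw [extMap_apply]
    simp [h1]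
  map_mul' g h := by
    refine LinearMap.ext fun x => ?_
    rw [Module.End.mul_apply, extMap_apply, extMap_apply, extMap_apply]
    simp only [hβ, map_mul, Module.End.mul_apply, map_add, map_sum, map_smul, smul_add,
      Finset.sum_add_distrib, add_assoc]

theorem extRep_apply (ρ : Representation R G K) (β : Fin n → G → K)
    (hβ : ∀ i g h, β i (g * h) = ρ g (β i h) + β i g) (g : G) (x : K × (Fin n → R)) :
    extRep ρ β hβ g x = (ρ g x.1 + ∑ i, x.2 i • β i g, x.2) := rfl

theorem isLocallyConstant_extRep [TopologicalSpace G] {ρ : Representation R G K}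
    (hρ : IsLocallyConstant fun g => ρ g) {β : Fin n → G → K} (hβl : ∀ i, IsLocallyConstant (β i))
    (hβ : ∀ i g h, β i (g * h) = ρ g (β i h) + β i g) :
    IsLocallyConstant fun g => extRep ρ β hβ g := by
  have h1 : IsLocallyConstant fun g => fun i => β i g := by
    rw [IsLocallyConstant.iff_eventually_eq]
    intro g
    filter_upwards [Filter.eventually_all.2 fun i => (hβl i).eventually_eq g] with y hy
    exact funext hy
  exact hρ.comp₂ h1 extMap

/-- Coordinates on a product. -/
def appendEquiv {m : ℕ} (b : K ≃ₗ[R] (Fin m → R)) : (K × (Fin n → R)) ≃ₗ[R] (Fin (m + n) → R) where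
  toFun x := Fin.append (b x.1) x.2
  map_add' x y := by
    ext j
    refine Fin.addCases (fun i => ?_) (fun i => ?_) j <;> simp
  map_smul' t x := by
    ext j
    refine Fin.addCases (fun i => ?_) (fun i => ?_) j <;> simp
  invFun y := (b.symm fun i => y (Fin.castAdd n i), fun i => y (Fin.natAdd m i))
  left_inv x := by simp
  right_inv y := by
    ext j
    refine Fin.addCases (fun i => ?_) (fun i => ?_) j <;> simp

theorem IsUnitriangular.extRep {m : ℕ} {ρ : Representation R G K} {b : K ≃ₗ[R] (Fin m → R)}
    (hb : IsUnitriangular ρ b) (β : Fin n → G → K)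
    (hβ : ∀ i g h, β i (g * h) = ρ g (β i h) + β i g) :
    IsUnitriangular (extRep ρ β hβ) (appendEquiv b) := by
  intro k x hx g j hj
  change Fin.append (b (ρ g x.1 + ∑ i, x.2 i • β i g)) x.2 j = Fin.append (b x.1) x.2 j
  have hx' : ∀ j : Fin (m + n), k + 1 ≤ j → Fin.append (b x.1) x.2 j = 0 := hx
  induction j using Fin.addCases with
  | right i => simp
  | left i =>
    -- Here `k ≤ i < m`, so all coordinates of the second block come after `k` and vanish by
    -- hypothesis.
    have hx2 : x.2 = 0 := by
      ext l
      have h1 := hx' (Fin.natAdd m l) (by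
        have := i.2
        simp only [Fin.val_castAdd, Fin.val_natAdd] at hj ⊢
        omega)
      rwa [Fin.append_right] at h1
    rw [Fin.append_left, Fin.append_left, hx2]
    simp only [Pi.zero_apply, zero_smul, Finset.sum_const_zero, add_zero]
    refine hb k x.1 (fun j hj => ?_) g i hj
    have h1 := hx' (Fin.castAdd n j) hj
    rwa [Fin.append_left] at h1

end Extension

/-! ### Unipotent lifts with surjective reduction on `H¹` -/

section UnipotentLift

variable {p r : ℕ} [Fact p.Prime] {G : Type u} [Group G] [TopologicalSpace G] [IsTopologicalGroup G]
  [CompactSpace G] [T2Space G] [TotallyDisconnectedSpace G]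

-- A `P`-fixed vector in the dual representation, which is `Γ`-fixed because the images agree.
omit [CompactSpace G] [T2Space G] [TotallyDisconnectedSpace G] in
theorem IsProPSylow.exists_invariant_functional {P : Subgroup G} (hP : IsProPSylow p P)
    {W : Type*} [AddCommGroup W] [Module (ZMod p) W] [Module.Finite (ZMod p) W] [Nontrivial W]
    {σ : Representation (ZMod p) G W} (hσ : IsLocallyConstant fun g => σ g)
    (hσP : ∀ g, ∃ x : P, σ x = σ g) :
    ∃ f : Module.Dual (ZMod p) W, f ≠ 0 ∧ ∀ g w, f (σ g w) = f w := by
  have : Finite (Module.Dual (ZMod p) W) := Module.finite_of_finite (ZMod p)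
  let τ : Representation (ZMod p) P (Module.Dual (ZMod p) W) := σ.dual.comp P.subtype
  have hτ : IsLocallyConstant fun x : P => τ x :=
    ((hσ.comp_continuous continuous_inv).comp_continuous continuous_subtype_val).comp
      (fun A : W →ₗ[ZMod p] W => Module.Dual.transpose (R := ZMod p) A)
  obtain ⟨f, hf0, hf⟩ := hP.isProP.exists_fixed_ne_zero τ (hτ.isOpen_fiber 1)
  refine ⟨f, hf0, fun g w => ?_⟩
  obtain ⟨x, hx⟩ := hσP g
  have h1 := LinearMap.congr_fun (hf x⁻¹) w
  have h2 : τ x⁻¹ f w = f (σ ((x⁻¹ : P) : G)⁻¹ w) := rfl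
  rw [h2] at h1
  rw [← hx]
  simpa using h1

/-- Every unipotent representation over `𝔽_p` has a unipotent lift to `ℤ/p^r` whose reduction map
on `H¹` is onto. -/
theorem exists_unitriangular_lift (hr : r ≠ 0) {P : Subgroup G}
    (hP : IsProPSylow p P) (hD : IsDemushkin p P) (hH90 : LiftsCharacters p r P hr) (N : ℕ) :
    ∀ (W : Type v) [AddCommGroup W] [Module (ZMod p) W] [Module.Finite (ZMod p) W]
      (σ : Representation (ZMod p) G W), Module.finrank (ZMod p) W = N →
      (IsLocallyConstant fun g => σ g) → (∀ g, ∃ x : P, σ x = σ g) →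
      ∃ (V : Type v) (_ : AddCommGroup V) (_ : Module (ZMod (p ^ r)) V)
        (ρ : Representation (ZMod (p ^ r)) G V) (π : V →+ W)
        (b : V ≃ₗ[ZMod (p ^ r)] (Fin N → ZMod (p ^ r))),
        (IsLocallyConstant fun g => ρ g) ∧ IsUnitriangular ρ b ∧ IsReduction ρ σ π ∧
        ∀ c ∈ Z1 σ, ∃ b ∈ Z1 ρ, ∀ g, π (b g) = c g := by
  induction N using Nat.strong_induction_on with
  | _ N ih =>
    intro W _ _ _ σ hN hσ hσP
    rcases subsingleton_or_nontrivial W with hW | hW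
    · obtain rfl : N = 0 := by rw [← hN, Module.finrank_zero_of_subsingleton]
      refine ⟨PUnit, inferInstance, inferInstance, Representation.trivial _ _ _, 0,
        LinearEquiv.ofSubsingleton _ _, IsLocallyConstant.const 1, fun _ _ _ _ j => j.elim0,
        ⟨fun w => ⟨0, Subsingleton.elim _ _⟩, fun _ _ => Subsingleton.elim _ _,
          fun v => ⟨fun _ => ⟨0, rfl⟩, fun _ => rfl⟩⟩,
        fun c _ => ⟨0, Submodule.zero_mem _, fun g => Subsingleton.elim _ _⟩⟩
    obtain ⟨f₀, hf₀, hf₀inv⟩ := hP.exists_invariant_functional hσ hσP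
    obtain ⟨n, f, hfli, hfinv, hfspan⟩ := exists_basis_invariant_functionals σ
    have hfsurj := surjective_pi_of_linearIndependent hfli
    have hK : ∃ S : Subrepresentation σ, ∀ w, w ∈ S.toSubmodule ↔ ∀ i, f i w = 0 :=
      ⟨⟨LinearMap.ker (LinearMap.pi f), fun g v hv => by
        ext i
        change f i (σ g v) = 0
        rw [hfinv]
        exact congrFun hv i⟩, fun w => funext_iff⟩
    obtain ⟨S, hS⟩ := hK
    have hrank : Module.finrank (ZMod p) S.toSubmodule + n = N := by
      have h1 : S.toSubmodule = LinearMap.ker (LinearMap.pi f) := by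
        ext w
        rw [hS]
        exact funext_iff.symm
      have h2 := LinearMap.finrank_range_add_finrank_ker (LinearMap.pi f)
      rw [LinearMap.range_eq_top.2 hfsurj, finrank_top, Module.finrank_fin_fun] at h2
      rw [h1, ← hN]
      omega
    -- The nonzero invariant functional `f₀` forces `S` to have smaller rank, so that the induction
    -- applies.
    have hn : n ≠ 0 := by
      rintro rfl
      obtain ⟨a, ha⟩ := hfspan f₀ hf₀inv
      rw [Finset.univ_eq_empty, Finset.sum_empty] at ha
      exact hf₀ ha
    have hSl : IsLocallyConstant fun g => S.toRepresentation g := by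
      rw [IsLocallyConstant.iff_eventually_eq] at hσ ⊢
      intro g
      filter_upwards [hσ g] with x hx
      ext w
      exact congrArg (fun A : W →ₗ[ZMod p] W => A w) hx
    obtain ⟨K, _, _, ρK, πK, bK, hρK, hbK, hπK, hliftK⟩ := ih _ (by omega) S.toSubmodule
      S.toRepresentation rfl hSl (fun g => by
        obtain ⟨x, hx⟩ := hσP g
        refine ⟨x, LinearMap.ext fun w => Subtype.ext ?_⟩
        exact congrArg (fun A : W →ₗ[ZMod p] W => A w) hx)
    choose w hw using fun i : Fin n => hfsurj (Pi.single i 1)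
    have hfw : ∀ i j, f i (w j) = if i = j then 1 else 0 := fun i j => by
      have := congrFun (hw j) i
      rwa [Pi.single_apply] at this
    -- The cocycles `σ g (w i) - w i` take values in `S` and describe `W` as an extension of `𝔽_pⁿ`.
    -- They lift to `K` by the surjectivity included in the induction hypothesis.
    have hcl : ∀ i, ∃ β ∈ Z1 ρK, ∀ g, (πK (β g) : W) = σ g (w i) - w i := fun i => by
      obtain ⟨β, hβ, hβc⟩ := hliftK
        (fun g => ⟨σ g (w i) - w i, (hS _).2 fun j => by rw [map_sub, hfinv, sub_self]⟩)
        ⟨by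
          refine IsLocallyConstant.desc _ S.toSubmodule.subtype ?_ S.toSubmodule.injective_subtype
          exact hσ.comp (fun A => A (w i) - w i), fun g h => Subtype.ext (by
            change σ (g * h) (w i) - w i = σ g (σ h (w i) - w i) + (σ g (w i) - w i)
            rw [map_mul, Module.End.mul_apply, map_sub]
            abel)⟩
      exact ⟨β, hβ, fun g => congrArg Subtype.val (hβc g)⟩
    choose β hβ hβw using hcl
    have hβc : ∀ i g h, β i (g * h) = ρK g (β i h) + β i g := fun i => (hβ i).2
    let ρ := extRep ρK β hβc
    let π : K × (Fin n → ZMod (p ^ r)) →+ W :=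
      { toFun := fun x => (πK x.1 : W) + ∑ i, redP p hr (x.2 i) • w i
        map_zero' := by simp
        map_add' := fun x y => by
          simp only [Prod.fst_add, Prod.snd_add, Pi.add_apply, map_add, add_smul,
            Finset.sum_add_distrib, Submodule.coe_add]
          abel }
    have hπ_apply : ∀ x, π x = (πK x.1 : W) + ∑ i, redP p hr (x.2 i) • w i := fun _ => rfl
    have hfπ : ∀ i x, f i (π x) = redP p hr (x.2 i) := fun i x => by
      rw [hπ_apply, map_add, (hS _).1 (πK x.1).2 i, map_sum]
      simp [hfw]
    have hπ : IsReduction ρ σ π := by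
      refine ⟨fun x => ?_, fun g x => ?_, fun x => ⟨fun hx => ?_, ?_⟩⟩
      · have hx : x - ∑ i, f i x • w i ∈ S.toSubmodule := (hS _).2 fun j => by
          simp [map_sum, hfw]
        obtain ⟨k, hk⟩ := hπK.surjective ⟨_, hx⟩
        choose t ht using fun i => redP_surjective hr (f i x)
        refine ⟨(k, t), ?_⟩
        rw [hπ_apply, hk]
        simp [ht]
      · have h1 : ((πK (ρK g x.1) : S.toSubmodule) : W) = σ g (πK x.1 : W) :=
          congrArg Subtype.val (hπK.map_apply g x.1)
        have h2 : ∀ i, ((πK (x.2 i • β i g) : S.toSubmodule) : W) =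
            redP p hr (x.2 i) • (σ g (w i) - w i) := fun i => by
          rw [map_smul_redP πK hr, Submodule.coe_smul, hβw]
        rw [hπ_apply, hπ_apply, extRep_apply]
        simp only [map_add, map_sum, Submodule.coe_add, Submodule.coe_sum, h1, h2, map_smul,
          smul_sub, Finset.sum_sub_distrib]
        abel
      · have h1 : ∀ i, redP p hr (x.2 i) = 0 := fun i => by rw [← hfπ, hx, map_zero]
        have h2 : πK x.1 = 0 := Subtype.ext (by
          rw [hπ_apply] at hx
          simpa [h1] using hx)
        obtain ⟨k, hk⟩ := (hπK.eq_zero_iff _).1 h2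
        choose t ht using fun i => (redP_eq_zero_iff hr _).1 (h1 i)
        exact ⟨(k, t), Prod.ext hk (funext ht)⟩
      · rintro ⟨x', rfl⟩
        rw [map_smul_redP π hr, redP_natCast, ZMod.natCast_self, zero_smul]
    have hρ := isLocallyConstant_extRep hρK (fun i => (hβ i).1) hβc
    have hfreeK : Module.Free (ZMod (p ^ r)) K := Module.Free.of_equiv bK.symm
    have hfinK : Module.Finite (ZMod (p ^ r)) K := Module.Finite.equiv bK.symm
    subst hrank
    refine ⟨K × (Fin n → ZMod (p ^ r)), inferInstance, inferInstance, ρ, π, appendEquiv bK, hρ,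
      hbK.extRep β hβc, hπ, fun c hc => ?_⟩
    -- An invariant functional on `W` is a combination of the `f i`, that is, of the coordinates on
    -- `𝔽_pⁿ`. Lifting its coefficients gives an invariant functional on `V`, since `Γ` acts
    -- trivially on the quotient `(ℤ/p^r)ⁿ`.
    refine hπ.exists_lift_Z1_of_functionals hr hP hD hH90 (isOpen_ker hρ) hσP (fun f' hf' => ?_) hc
    obtain ⟨a, rfl⟩ := hfspan f' hf'
    choose a' ha' using fun i => redP_surjective hr (a i)
    refine ⟨(∑ i, a' i • LinearMap.proj i) ∘ₗ LinearMap.snd _ _ _, fun g x => rfl, fun x => ?_⟩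
    simp [hfπ, ha']

end UnipotentLift

/-! ### Translation to `H1.reduction` and to the wH90 hypothesis -/

section Reduction

variable {p : ℕ} {R G V : Type*} [CommRing R] [Group G] [TopologicalSpace G] [AddCommGroup V]
  [Module R V]

theorem surjective_reduction {ρ : Representation R G V}
    (h : ∀ c ∈ Z1 (modP p ρ), ∃ b ∈ Z1 ρ, ∀ g, quotMap (pMul p ρ) (b g) = c g) :
    Function.Surjective (H1.reduction p ρ) := by
  intro x
  obtain ⟨c, rfl⟩ := Submodule.Quotient.mk_surjective _ x
  obtain ⟨b, hb, hbc⟩ := h c.1 c.2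
  refine ⟨Submodule.Quotient.mk ⟨b, hb⟩, ?_⟩
  exact congrArg Submodule.Quotient.mk (Subtype.ext (funext hbc))

/-- A representation on an `𝔽_p`-vector space, as an `𝔽_p`-linear representation. -/
def toZModRep (p : ℕ) [Module (ZMod p) V] (σ : Representation R G V) :
    Representation (ZMod p) G V where
  toFun g := (σ g).toAddMonoidHom.toZModLinearMap p
  map_one' := by
    ext v
    exact congrArg (fun A : V →ₗ[R] V => A v) (map_one σ)
  map_mul' g h := by
    ext v
    exact congrArg (fun A : V →ₗ[R] V => A v) (map_mul σ g h)

/-- `V/p` is only given as a `ℤ/p^r`-module. Equipping it with its `𝔽_p`-structure makes the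
criterion applicable, and functionals on it pull back to semilinear ones on `V`. -/
theorem surjective_reduction_of_functionals {p r : ℕ} [Fact p.Prime] {G V : Type*} [Group G]
    [TopologicalSpace G] [IsTopologicalGroup G] [CompactSpace G] [T2Space G]
    [TotallyDisconnectedSpace G] (hr : r ≠ 0) {P : Subgroup G}
    (hP : IsProPSylow p P) (hD : IsDemushkin p P) (hH90 : LiftsCharacters p r P hr)
    [AddCommGroup V] [Module (ZMod (p ^ r)) V]
    [Module.Free (ZMod (p ^ r)) V] [Module.Finite (ZMod (p ^ r)) V]
    {ρ : Representation (ZMod (p ^ r)) G V} (hρ : IsOpen {g : G | ρ g = 1})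
    (hρP : ∀ g, ∃ x : P, ρ x = ρ g)
    (hfun : ∀ f : V →ₛₗ[redP p hr] ZMod p, (∀ g v, f (ρ g v) = f v) →
      ∃ f' : V →ₗ[ZMod (p ^ r)] ZMod (p ^ r), (∀ g v, f' (ρ g v) = f' v) ∧
        ∀ v, redP p hr (f' v) = f v) : Function.Surjective (H1.reduction p ρ) := by
  have hfin : Finite V := Module.finite_of_finite (ZMod (p ^ r))
  have hpQ : ∀ x : V ⧸ (pMul p ρ).toSubmodule, p • x = 0 := fun x => by
    obtain ⟨v, rfl⟩ := Submodule.Quotient.mk_surjective _ x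
    exact (Submodule.Quotient.mk_eq_zero _).2 ⟨v, by simp [Nat.cast_smul_eq_nsmul]⟩
  let : Module (ZMod p) (V ⧸ (pMul p ρ).toSubmodule) := AddCommGroup.zmodModule hpQ
  have hfinQ : Finite (V ⧸ (pMul p ρ).toSubmodule) :=
    Finite.of_surjective _ (Submodule.Quotient.mk_surjective _)
  have hfinQ' : Module.Finite (ZMod p) (V ⧸ (pMul p ρ).toSubmodule) := Module.Finite.of_finite
  let σ : Representation (ZMod p) G (V ⧸ (pMul p ρ).toSubmodule) := toZModRep p (modP p ρ)
  let π : V →+ V ⧸ (pMul p ρ).toSubmodule := (pMul p ρ).toSubmodule.mkQ.toAddMonoidHom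
  have hπ : IsReduction ρ σ π := by
    refine ⟨Submodule.Quotient.mk_surjective _, fun g v => rfl, fun v => ?_⟩
    refine (Submodule.Quotient.mk_eq_zero _).trans ?_
    exact ⟨fun ⟨y, hy⟩ => ⟨y, hy.symm⟩, fun ⟨y, hy⟩ => ⟨y, hy.symm⟩⟩
  have key : ∀ c ∈ Z1 σ, ∃ b ∈ Z1 ρ, ∀ g, π (b g) = c g := fun c hc => by
    refine hπ.exists_lift_Z1_of_functionals hr hP hD hH90 hρ (fun g => ?_) (fun f hf => ?_) hc
    · obtain ⟨x, hx⟩ := hρP g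
      refine ⟨x, LinearMap.ext fun y => ?_⟩
      obtain ⟨v, rfl⟩ := hπ.surjective y
      rw [← hπ.map_apply, ← hπ.map_apply, hx]
    · exact hfun
        { toFun := fun v => f (π v)
          map_add' := fun v w => by rw [map_add, map_add]
          map_smul' := fun a v => by rw [map_smul_redP π hr, map_smul] }
        (fun g v => by
          change f (π (ρ g v)) = f (π v)
          rw [hπ.map_apply, hf])
  exact surjective_reduction fun c hc => key c hc

/-- With trivial action there are no nonzero coboundaries, so lifting classes is the same as lifting
cocycles, which are the characters. -/
theorem liftsCharacters_of_weakH90 {p : ℕ} [Fact p.Prime] {Γ : Type*} [Group Γ]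
    [TopologicalSpace Γ] {χ : Γ →* ℤ_[p]ˣ} (hχ : WeakH90 p χ) {r : ℕ} (hr : 2 ≤ r) (hr0 : r ≠ 0)
    (htriv : Nonempty ((tate p χ r).Equiv
      (Representation.trivial (ZMod (p ^ r)) Γ (ZMod (p ^ r)))))
    {P : Subgroup Γ} (hP : IsProPSylow p P) : LiftsCharacters p r P hr0 := by
  obtain ⟨e⟩ := htriv
  have ht : ∀ g x, tate p χ r g x = x := fun g x =>
    e.toLinearEquiv.injective
      (Representation.IntertwiningMap.isIntertwining _ _ e.toIntertwiningMap g x)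
  intro a ha
  let ρ : Representation (ZMod (p ^ r)) P (ZMod (p ^ r)) := (tate p χ r).comp P.subtype
  have htρ : ∀ g x, ρ g x = x := fun g x => ht g x
  let s := Function.surjInv (redP_surjective (p := p) hr0)
  have hs : ∀ y, redP p hr0 (s y) = y := Function.surjInv_eq (redP_surjective hr0)
  have hmem : ∀ x : ZMod (p ^ r), x ∈ (pMul p ρ).toSubmodule ↔ redP p hr0 x = 0 := fun x => by
    rw [redP_eq_zero_iff]
    exact ⟨fun ⟨y, hy⟩ => ⟨y, hy.symm⟩, fun ⟨y, hy⟩ => ⟨y, hy.symm⟩⟩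
  have hc : (fun g => Submodule.Quotient.mk (s (a g))) ∈ Z1 (modP p ρ) := by
    refine ⟨ha.1.comp (fun y => Submodule.Quotient.mk (s y)), fun g h => ?_⟩
    change _ = Submodule.Quotient.mk (ρ g (s (a h))) + _
    rw [htρ, ← Submodule.Quotient.mk_add, Submodule.Quotient.eq, hmem, map_sub, map_add, hs, hs, hs,
      ha.2, Representation.trivial_apply, sub_self]
  obtain ⟨x, hx⟩ := hχ P hP r hr (Submodule.Quotient.mk ⟨_, hc⟩)
  obtain ⟨b, rfl⟩ := Submodule.Quotient.mk_surjective _ x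
  obtain ⟨m, hm⟩ := (Submodule.Quotient.eq _).1 hx
  obtain ⟨m, rfl⟩ := Submodule.Quotient.mk_surjective _ m
  refine ⟨b.1, ⟨b.2.1, fun g h => ?_⟩, fun g => ?_⟩
  · rw [b.2.2, Representation.trivial_apply]
    exact congrArg (· + _) (htρ g _)
  · have h1 : Submodule.Quotient.mk (b.1 g) - Submodule.Quotient.mk (s (a g)) =
        (Submodule.Quotient.mk (ρ g m) - Submodule.Quotient.mk m :
          ZMod (p ^ r) ⧸ (pMul p ρ).toSubmodule) := hm g
    rw [htρ, sub_self, ← Submodule.Quotient.mk_sub, Submodule.Quotient.mk_eq_zero, hmem, map_sub,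
      hs, sub_eq_zero] at h1
    exact h1

end Reduction
end KummerFlags

theorem mainTheorem4 {Γ : Type u} [Group Γ] [TopologicalSpace Γ] [IsTopologicalGroup Γ]
    [CompactSpace Γ] [T2Space Γ] [TotallyDisconnectedSpace Γ]
    (p : ℕ) [Fact p.Prime] (χ : Γ →ₜ* ℤ_[p]ˣ)
    (hΓ : KummerFlags.IsPManageable p (χ : Γ →* ℤ_[p]ˣ))
    (r : ℕ) (hr : 2 ≤ r)
    (htriv : Nonempty ((KummerFlags.tate p (χ : Γ →* ℤ_[p]ˣ) r).Equiv
      (Representation.trivial (ZMod (p ^ r)) Γ (ZMod (p ^ r))))) :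
    (∀ (d : ℕ) (V : Type v) [AddCommGroup V] [Module (ZMod (p ^ r)) V]
      (ρ : Representation (ZMod (p ^ r)) Γ V) (F : ℕ → Subrepresentation ρ),
      KummerFlags.IsBundle ρ d → KummerFlags.IsCompleteFlag ρ d F →
      KummerFlags.IsKummer p d ρ F →
      Function.Surjective (KummerFlags.H1.reduction p ρ)) ∧
    (∀ (d : ℕ) (V₁ : Type v) [AddCommGroup V₁] [Module (ZMod p) V₁]
      (ρ₁ : Representation (ZMod p) Γ V₁),
      KummerFlags.IsBundle ρ₁ d → KummerFlags.IsUnipotent ρ₁ →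
      ∃ (V : Type v) (_ : AddCommGroup V) (_ : Module (ZMod (p ^ r)) V)
        (ρ : Representation (ZMod (p ^ r)) Γ V),
        KummerFlags.IsBundle ρ d ∧ KummerFlags.IsUnipotent ρ ∧
        (∃ e : (V ⧸ (KummerFlags.pMul p ρ).toSubmodule) ≃+ V₁,
          ∀ g x, e (KummerFlags.modP p ρ g x) = ρ₁ g (e x)) ∧
        Function.Surjective (KummerFlags.H1.reduction p ρ)) := by
  have hp : p.Prime := Fact.out
  have hr0 : r ≠ 0 := by omega
  have : Fact (1 < p ^ r) := ⟨Nat.one_lt_pow hr0 hp.one_lt⟩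
  obtain ⟨P, hP, hD⟩ := hΓ.demushkin
  have hH90 := KummerFlags.liftsCharacters_of_weakH90 hΓ.wH90 hr hr0 htriv hP
  refine ⟨fun d V _ _ ρ F hV hF hK => ?_, fun d V₁ _ _ ρ₁ hV₁ ⟨d', F, hF, hFt⟩ => ?_⟩
  · have := hV.free
    have := hV.finite
    have hpieces : ∀ k, 1 ≤ k → k ≤ d → KummerFlags.TrivialPiece F k := by
      cases d with
      | zero => intro k h1 h2; omega
      | succ d => exact hK.2.1
    refine KummerFlags.surjective_reduction_of_functionals hr0 hP hD hH90 hV.continuous (fun g => ?_)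
      (fun f hf => ?_)
    · exact hP.exists_apply_eq hV.continuous
        (KummerFlags.exists_pow_eq_one hp KummerFlags.natCast_pow_eq_zero hF.zero hF.top hpieces) g
    · exact hK.exists_lift_functional hr0 d hF.zero hF.top hF.mono f hf
  · have := hV₁.finite
    have hloc := KummerFlags.isLocallyConstant_of_isOpen_ker hV₁.continuous
    obtain ⟨V, _, _, ρ, π, b, hρ, hb, hπ, hlift⟩ := KummerFlags.exists_unitriangular_lift hr0 hP hD
      -- The common image of `P` and `Γ` comes from the given unipotent flag, over `𝔽_p`, where the
      -- first power of `p` is already zero.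
      hH90 d V₁ ρ₁ hV₁.rank hloc (hP.exists_apply_eq hV₁.continuous
        (KummerFlags.exists_pow_eq_one (r := 1) hp (by simp) hF.zero hF.top hFt))
    have hker : ∀ v, v ∈ (KummerFlags.pMul p ρ).toSubmodule ↔ π v = 0 := fun v => by
      rw [hπ.eq_zero_iff]
      exact ⟨fun ⟨y, hy⟩ => ⟨y, hy.symm⟩, fun ⟨y, hy⟩ => ⟨y, hy.symm⟩⟩
    let π' : V →ₛₗ[KummerFlags.redP p hr0] V₁ :=
      { toFun := π
        map_add' := map_add π
        map_smul' := KummerFlags.map_smul_redP π hr0 }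
    let E : (V ⧸ (KummerFlags.pMul p ρ).toSubmodule) →+ V₁ :=
      ((KummerFlags.pMul p ρ).toSubmodule.liftQ π' fun v hv => (hker v).1 hv).toAddMonoidHom
    have hE : ∀ v, E (Submodule.Quotient.mk v) = π v := fun v => rfl
    have hEbij : Function.Bijective E := by
      refine ⟨(injective_iff_map_eq_zero E).2 fun x hx => ?_, fun y => ?_⟩
      · obtain ⟨v, rfl⟩ := Submodule.Quotient.mk_surjective _ x
        exact (Submodule.Quotient.mk_eq_zero _).2 ((hker v).2 hx)
      · obtain ⟨v, rfl⟩ := hπ.surjective y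
        exact ⟨Submodule.Quotient.mk v, rfl⟩
    have hEeq : ∀ g x, E (KummerFlags.modP p ρ g x) = ρ₁ g (E x) := fun g x => by
      obtain ⟨v, rfl⟩ := Submodule.Quotient.mk_surjective _ x
      exact hπ.map_apply g v
    refine ⟨V, inferInstance, inferInstance, ρ, ⟨Module.Free.of_equiv b.symm,
      Module.Finite.equiv b.symm, by rw [b.finrank_eq, Module.finrank_fin_fun],
      KummerFlags.isOpen_ker hρ⟩, hb.isUnipotent, ⟨AddEquiv.ofBijective E hEbij, hEeq⟩,
      KummerFlags.surjective_reduction fun c hc => ?_⟩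
    -- A cocycle in `V/p` is carried by `E` to `V₁`, lifted there, and compared through the
    -- injectivity of `E`.
    obtain ⟨b', hb', hbc⟩ := hlift _ (KummerFlags.map_mem_Z1 (σ := ρ₁) E hEeq hc)
    exact ⟨b', hb', fun g => hEbij.1 (hbc g)⟩
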